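/- Let $X$ be an $n$-dimensional Fano manifold (a compact connected complex manifold with $-K_X$ ample), let $k\ge 1$ be such that $-kK_X$ is very ample, and put $N=N_k=\dim H^0(X,-kK_X)$. Let $\mathcal B_k$ be the space of positive definite hermitian forms on $H^0(X,-kK_X)$. For $H\in\mathcal B_k$ let $FS_k(H)$ be the metric on $-K_X$ with local weights $\frac1k\log\bigl(k^{-n}\sup_{s\ne0}|s|^2/H(s,s)\bigr)$. For a metric $\phi$ on $-K_X$ let $e^{-\phi}$ be the volume form given in local holomorphic coordinates $z$ by $(\sqrt{-1})^{n^2}\,|\partial_{z_1}\wedge\cdots\wedge\partial_{z_n}|^2_\phi\,dz_1\wedge\cdots\wedge dz_n\wedge d\bar z_1\wedge\cdots\wedge d\bar z_n$, let $\mu_\phi=e^{-\phi}/\int_Xe^{-\phi}$, and let $\mathcal L(\phi)=-\log\int_Xe^{-\phi}$. Fix $H_{\rm ref}\in\mathcal B_k$. The quantized Ding functional on $\mathcal B_k$ is $$\mathcal D^{(k)}(H)=\frac1{kN}\log\det(H\cdot H_{\rm ref}^{-1})+\mathcal L(FS_k(H)).$$ Fix $H_0\in\mathcal B_k$ and an $H_0$-orthonormal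 basis $\underline s_0=(s_1,\dots,s_N)$. It defines an embedding of $X$ into $\mathbb{CP}^{N-1}$ by $x\mapsto[s_1(x):\cdots:s_N(x)]$; functions on $\mathbb{CP}^{N-1}$ are restricted to $X$ by means of it. For $g\in GL(N,\mathbb C)$ let $H_g\in\mathcal B_k$ be the form for which $\underline s_0\cdot g$ is orthonormal. The map $g\mapsto H_g$ identifies $GL(N,\mathbb C)/U(N)$ with $\mathcal B_k$, and a hermitian $N\times N$ matrix $A$ with the tangent vector $\frac{d}{dt}\big|_{t=0}H_{e^{tA/2}}$ at $H_0$. Give $\mathcal B_k$ the $GL(N,\mathbb C)$-invariant Riemannian metric that equals $\mathrm{tr}(AB)$ at $H_0$. On $\mathbb{CP}^{N-1}$ with homogeneous coordinates $Z$ let $M=\bigl(\bar Z_\alpha Z_\beta/\sum_i|Z_i|^2\bigr)_{\alpha\beta}$, let $(\cdot,\cdot)_{FS}$ be the hermitian inner product on holomorphic tangent vectors with components $\partial_i\partial_{\bar j}\log|Z|^2$, and let $\omega_{FS}=\frac{\sqrt{-1}}{2\pi}\partial\bar\partial\log|Z|^2$. For a hermitian matrix $A$ let $\xi_A$ be the holomorphic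 vector field on $\mathbb{CP}^{N-1}$ induced by $\sum_{i,j}A_{ij}Z_i\,\partial/\partial Z_j$, write $\xi_A=\xi_A^{\mathbb R}-\sqrt{-1}J\xi_A^{\mathbb R}$ with $\xi_A^{\mathbb R}$ real, and let $H(A)=\mathrm{tr}(AM)$. Then $\mathcal D^{(k)}$ is twice continuously differentiable at $H_0$, and for all hermitian matrices $A,B$ its Riemannian Hessian at $H_0$ is, with $\mu=\mu_{FS_k(H_0)}$, $$\nabla^2\mathcal D^{(k)}|_{H_0}(A,B)=k^{-1}\int_X\mathrm{Re}(\xi_A,\xi_B)_{FS}\,\mu-k^{-2}\int_XH(A)H(B)\,\mu+k^{-2}\int_XH(A)\,\mu\cdot\int_XH(B)\,\mu.$$ Moreover $H(A)$ is the Hamiltonian of $J\xi_A^{\mathbb R}$, in the sense that $i_{J\xi_A^{\mathbb R}}\omega_{FS}=-\frac1{4\pi}dH(A)$. -/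

import Mathlib

open scoped Manifold ContDiff Matrix LinearAlgebra.Projectivization Matrix.Norms.Operator

namespace QuantizedDing

noncomputable section

/-! ### Pluri-anticanonical bundles and their holomorphic sections -/

/-- The model space of an `n`-dimensional complex manifold. -/
abbrev Model (n : ℕ) : Type := Fin n → ℂ

theorem contDiff_det (n : ℕ) : ContDiff ℂ ω (fun f : Model n →L[ℂ] Model n => f.det) := by
  have h : (fun f : Model n →L[ℂ] Model n => f.det) =
      fun f => ∑ σ : Equiv.Perm (Fin n), ((Equiv.Perm.sign σ : ℤ) : ℂ) *
        ∏ i, f (Pi.single i 1) (σ i) := by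
    funext f
    rw [ContinuousLinearMap.det, ← LinearMap.det_toMatrix', Matrix.det_apply']
    simp [LinearMap.toMatrix'_apply]
  rw [h]
  refine ContDiff.sum fun σ _ => contDiff_const.mul (contDiff_prod fun i _ => ?_)
  exact ((ContinuousLinearMap.proj (R := ℂ) (φ := fun _ : Fin n => ℂ) (σ i)).comp
    (ContinuousLinearMap.apply ℂ (Model n) (Pi.single i 1 : Model n))).contDiff

section Manifold

variable (n : ℕ) (X : Type*) [TopologicalSpace X] [ChartedSpace (Model n) X]
  [IsManifold 𝓘(ℂ, Model n) ω X]

/-- The holomorphic line bundle `-k K_X = (Λⁿ T X)^{⊗ k}` of a complex manifold `X`.  It is given by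
its trivialisations over the charts of `X`: the chart `i = (z₁, …, zₙ)` provides the frame
`(∂/∂z₁ ∧ ⋯ ∧ ∂/∂zₙ)^{⊗ k}`.  If `J` is the Jacobian matrix of the change of charts from `i` to `j`
(the transition function of the tangent bundle), then the frame of `i` is `(det J)^k` times that
of `j`, so that coefficients are multiplied by `(det J)^k`. -/
def anticanonicalCore (k : ℕ) : VectorBundleCore ℂ X ℂ (atlas (Model n) X) where
  baseSet i := i.1.source
  isOpen_baseSet i := i.1.open_source
  indexAt := achart (Model n)
  mem_baseSet_at := mem_chart_source (Model n)
  coordChange i j x :=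
    (((tangentBundleCore 𝓘(ℂ, Model n) X).coordChange i j x).det ^ k) •
      ContinuousLinearMap.id ℂ ℂ
  coordChange_self i x hx v := by
    have h : (tangentBundleCore 𝓘(ℂ, Model n) X).coordChange i i x =
        ContinuousLinearMap.id ℂ (Model n) :=
      ContinuousLinearMap.ext fun w =>
        (tangentBundleCore 𝓘(ℂ, Model n) X).coordChange_self i x hx w
    rw [h]
    simp [ContinuousLinearMap.det]
  continuousOn_coordChange i j := by
    have h : ContinuousOn
        (fun x => ((tangentBundleCore 𝓘(ℂ, Model n) X).coordChange i j x).det)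
        (i.1.source ∩ j.1.source) :=
      (contDiff_det n).continuous.comp_continuousOn
        ((tangentBundleCore 𝓘(ℂ, Model n) X).continuousOn_coordChange i j)
    exact (h.pow k).smul continuousOn_const
  coordChange_comp i j l x hx v := by
    have h : (tangentBundleCore 𝓘(ℂ, Model n) X).coordChange i l x =
        ((tangentBundleCore 𝓘(ℂ, Model n) X).coordChange j l x).comp
          ((tangentBundleCore 𝓘(ℂ, Model n) X).coordChange i j x) :=
      ContinuousLinearMap.ext fun w =>
        ((tangentBundleCore 𝓘(ℂ, Model n) X).coordChange_comp i j l x hx w).symm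
    have hdet : ((tangentBundleCore 𝓘(ℂ, Model n) X).coordChange i l x).det =
        ((tangentBundleCore 𝓘(ℂ, Model n) X).coordChange j l x).det *
          ((tangentBundleCore 𝓘(ℂ, Model n) X).coordChange i j x).det := by
      rw [h]
      exact LinearMap.det_comp _ _
    rw [hdet]
    simp only [smul_apply, ContinuousLinearMap.id_apply, smul_eq_mul, mul_pow]
    ring

instance anticanonicalCore_isContMDiff (k : ℕ) :
    (anticanonicalCore n X k).IsContMDiff 𝓘(ℂ, Model n) ω where
  contMDiffOn_coordChange i j := by
    have hI : IsManifold 𝓘(ℂ, Model n) (ω + 1) X := by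
      simpa using (inferInstance : IsManifold 𝓘(ℂ, Model n) ω X)
    have hT : (tangentBundleCore 𝓘(ℂ, Model n) X).IsContMDiff 𝓘(ℂ, Model n) ω :=
      tangentBundleCore.isContMDiff
    have h1 : ContDiff ℂ ω (fun f : Model n →L[ℂ] Model n =>
        (f.det ^ k) • ContinuousLinearMap.id ℂ ℂ) :=
      ((contDiff_det n).pow k).smul contDiff_const
    exact h1.contMDiff.comp_contMDiffOn (hT.contMDiffOn_coordChange i j)

/-- `H⁰(X, -k K_X)`, the complex vector space of holomorphic (that is, complex analytic) sections
of `-k K_X`. -/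
abbrev H0 (k : ℕ) : Type _ :=
  ContMDiffSection 𝓘(ℂ, Model n) ℂ ω (anticanonicalCore n X k).Fiber

variable {n X}

/-- The coefficient of the section `s` of `-k K_X` at the point `x` with respect to the frame
`(∂/∂z₁ ∧ ⋯ ∧ ∂/∂zₙ)^{⊗ k}` of the chart `i` (meaningful for `x` in the source of `i`). -/
def coeff {k : ℕ} (i : atlas (Model n) X) (s : H0 n X k) (x : X) : ℂ :=
  ((anticanonicalCore n X k).localTriv i ⟨x, s x⟩).2

variable (n X)

/-- `-k K_X` is very ample: its holomorphic sections have no common zeros, separate points, and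
separate tangent vectors. -/
structure IsVeryAmple (k : ℕ) : Prop where
  basePointFree : ∀ x : X, ∃ s : H0 n X k, s x ≠ 0
  separatesPoints : ∀ x y : X, x ≠ y → ∃ s : H0 n X k, s x = 0 ∧ s y ≠ 0
  separatesTangents : ∀ (x : X) (v : TangentSpace 𝓘(ℂ, Model n) x), v ≠ 0 →
    ∃ s : H0 n X k, s x = 0 ∧
      mfderiv 𝓘(ℂ, Model n) 𝓘(ℂ, ℂ) (coeff (achart (Model n) x) s) x v ≠ 0

/-- `-K_X` is ample, i.e. some positive multiple of it is very ample. -/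
def IsFano : Prop := ∃ m : ℕ, 0 < m ∧ IsVeryAmple n X m

end Manifold

/-! ### Hermitian forms -/

section Forms

variable {V : Type*} [AddCommGroup V] [Module ℂ V]

/-- Sesquilinear forms on `V`, conjugate linear in the first variable. -/
abbrev SesqForm (V : Type*) [AddCommGroup V] [Module ℂ V] : Type _ := V →ₗ⋆[ℂ] V →ₗ[ℂ] ℂ

/-- `H` is a (positive definite) hermitian form. The set of these is the space `𝓑_k` when
`V = H⁰(X, -k K_X)`. -/
def IsHermForm (H : SesqForm V) : Prop := H.IsSymm ∧ ∀ v, v ≠ 0 → 0 < (H v v).re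

variable {N : ℕ}

/-- The Gram matrix of `H` in the basis `b`. -/
def gram (b : Module.Basis (Fin N) ℂ V) (H : SesqForm V) : Matrix (Fin N) (Fin N) ℂ :=
  Matrix.of fun i j => H (b i) (b j)

/-- Hermitian matrices of size `N`, a real vector space (`√-1 𝔲(N)`). -/
abbrev HermMat (N : ℕ) : Type := selfAdjoint.submodule ℝ (Matrix (Fin N) (Fin N) ℂ)

/-- For a matrix `G = g gᴴ` with `g ∈ GL(N, ℂ)`, this is the hermitian form `H_g` for which
`s · g`, i.e. the family `(∑ᵢ g i j • s i)_j`, is orthonormal. Its Gram matrix in the basis `s` is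
`G⁻¹`.  As `g ↦ g gᴴ` identifies `GL(N, ℂ) / U(N)` with the open cone of positive definite matrices
in `HermMat N`, this parametrises all (positive definite) hermitian forms on `V` by that cone. -/
def formOf (s : Module.Basis (Fin N) ℂ V) (G : Matrix (Fin N) (Fin N) ℂ) : SesqForm V :=
  LinearMap.mk₂'ₛₗ (starRingEnd ℂ) (RingHom.id ℂ)
    (fun x y => star (⇑(s.repr x)) ⬝ᵥ (G⁻¹ *ᵥ ⇑(s.repr y)))
    (fun x y z => by simp [add_dotProduct])
    (fun c x y => by
      have h : star (⇑(c • s.repr x)) = (starRingEnd ℂ c) • star (⇑(s.repr x)) := by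
        ext i; simp
      rw [map_smul, h, smul_dotProduct])
    (fun x y z => by simp [Matrix.mulVec_add, dotProduct_add])
    (fun c x y => by simp [Matrix.mulVec_smul, dotProduct_smul])

theorem formOf_apply_basis (s : Module.Basis (Fin N) ℂ V) (G : Matrix (Fin N) (Fin N) ℂ)
    (i j : Fin N) : formOf s G (s i) (s j) = G⁻¹ i j := by
  simp [formOf, LinearMap.mk₂'ₛₗ_apply, Finsupp.single_eq_pi_single]

theorem formOf_orthonormal (s : Module.Basis (Fin N) ℂ V) (g : Matrix (Fin N) (Fin N) ℂ)
    (hg : IsUnit g.det) (a b : Fin N) :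
    formOf s (g * gᴴ) (∑ i, g i a • s i) (∑ j, g j b • s j) = if a = b then 1 else 0 := by
  have hg' : IsUnit (gᴴ).det := by rw [Matrix.det_conjTranspose]; exact hg.star
  have h : gᴴ * (g * gᴴ)⁻¹ * g = 1 := by
    rw [Matrix.mul_inv_rev, ← Matrix.mul_assoc, Matrix.mul_nonsing_inv _ hg', Matrix.one_mul,
      Matrix.nonsing_inv_mul _ hg]
  rw [← Matrix.one_apply, ← h]
  simp only [map_sum, LinearMap.sum_apply, LinearMap.map_smulₛₗ, LinearMap.smul_apply,
    formOf_apply_basis, Matrix.mul_apply, Finset.sum_mul, Matrix.conjTranspose_apply, smul_eq_mul,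
    Finset.mul_sum, RingHom.id_apply, starRingEnd_apply]
  exact Finset.sum_congr rfl fun i _ => Finset.sum_congr rfl fun j _ => by ring

end Forms

/-! ### The Riemannian structure of the space of hermitian forms -/

section Riemannian

variable {N : ℕ}

/-- The identity matrix. Under `formOf s` it corresponds to the form with orthonormal basis `s`. -/
def idHerm (N : ℕ) : HermMat N := ⟨1, IsSelfAdjoint.one _⟩

/-- The Riemannian metric on the cone of positive definite matrices that is invariant under
`G ↦ g G gᴴ`, `g ∈ GL(N, ℂ)`, and equal to `tr (U V)` at the identity. -/
def killingMetric (G U V : HermMat N) : ℝ := (G.1⁻¹ * U.1 * G.1⁻¹ * V.1).trace.re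

/-- The Christoffel symbols `Γ_G(U, V)` of the Levi-Civita connection of `killingMetric`, so that
`∇_U V = D_U V + Γ(U, V)` for vector fields `U`, `V`. -/
def christoffel (G U V : HermMat N) : HermMat N :=
  ⟨-((1 / 2 : ℝ) • (U.1 * G.1⁻¹ * V.1 + V.1 * G.1⁻¹ * U.1)), by
    have hG : star (G.1⁻¹) = G.1⁻¹ := by
      have h : star G.1 = G.1 := G.2
      rw [Matrix.star_eq_conjTranspose] at h ⊢
      rw [Matrix.conjTranspose_nonsing_inv, h]
    have hU : star U.1 = U.1 := U.2
    have hV : star V.1 = V.1 := V.2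
    change star (-((1 / 2 : ℝ) • (U.1 * G.1⁻¹ * V.1 + V.1 * G.1⁻¹ * U.1))) = _
    rw [star_neg, star_smul, star_add, star_mul, star_mul, star_mul, star_mul, hG, hU, hV,
      star_trivial, add_comm, Matrix.mul_assoc, Matrix.mul_assoc]⟩

theorem hasDerivAt_killingMetric (G U V W : HermMat N) (hG : IsUnit G.1.det) :
    HasDerivAt (fun t : ℝ => killingMetric (G + t • U) V W)
      (-(G.1⁻¹ * U.1 * G.1⁻¹ * V.1 * G.1⁻¹ * W.1).trace.re
        - (G.1⁻¹ * V.1 * G.1⁻¹ * U.1 * G.1⁻¹ * W.1).trace.re) 0 := by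
  have hunit : IsUnit G.1 := (Matrix.isUnit_iff_isUnit_det _).2 hG
  obtain ⟨u, hu⟩ := hunit
  have hinv : (↑u⁻¹ : Matrix (Fin N) (Fin N) ℂ) = G.1⁻¹ := by
    rw [← hu, Matrix.coe_units_inv]
  have h0 : HasDerivAt (fun t : ℝ => G.1 + t • U.1) U.1 0 := by
    have h := ((hasDerivAt_id (0 : ℝ)).smul_const U.1).const_add G.1
    rw [one_smul] at h
    exact h
  have h1 : HasDerivAt (fun t : ℝ => (G.1 + t • U.1)⁻¹) (-(G.1⁻¹ * U.1 * G.1⁻¹)) 0 := by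
    have hr := hasFDerivAt_ringInverse (𝕜 := ℝ) u
    have hr' : HasFDerivAt Ring.inverse
        (-((ContinuousLinearMap.mulLeftRight ℝ (Matrix (Fin N) (Fin N) ℂ)) ↑u⁻¹) ↑u⁻¹)
        (G.1 + (0 : ℝ) • U.1) := by simpa [hu] using hr
    have hc := hr'.comp_hasDerivAt (0 : ℝ) h0
    have hd : (-((ContinuousLinearMap.mulLeftRight ℝ (Matrix (Fin N) (Fin N) ℂ)) ↑u⁻¹) ↑u⁻¹) U.1
        = -(G.1⁻¹ * U.1 * G.1⁻¹) := by simp [hinv]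
    rw [hd] at hc
    simp only [Matrix.nonsing_inv_eq_ringInverse] at hc ⊢
    exact hc
  have h2 := (((h1.mul_const V.1).mul h1).mul_const W.1)
  let L : Matrix (Fin N) (Fin N) ℂ →L[ℝ] ℝ :=
    LinearMap.toContinuousLinearMap
      (Complex.reLm ∘ₗ (Matrix.traceLinearMap (Fin N) ℝ ℂ))
  have h3 := L.hasFDerivAt.comp_hasDerivAt (0 : ℝ) h2
  refine h3.congr_deriv ?_
  change (Matrix.trace (_ : Matrix (Fin N) (Fin N) ℂ)).re = _
  simp only [zero_smul, add_zero, Matrix.neg_mul, Matrix.mul_neg, Matrix.add_mul, Matrix.trace_add,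
    Matrix.trace_neg, Complex.add_re, Complex.neg_re, ← Matrix.mul_assoc]
  ring

/-- The Koszul formula: `christoffel` is the Levi-Civita connection of `killingMetric`. -/
theorem koszul (G U V W : HermMat N) (hG : IsUnit G.1.det) :
    2 * killingMetric G (christoffel G U V) W =
      deriv (fun t : ℝ => killingMetric (G + t • U) V W) 0
        + deriv (fun t : ℝ => killingMetric (G + t • V) U W) 0
        - deriv (fun t : ℝ => killingMetric (G + t • W) U V) 0 := by
  rw [(hasDerivAt_killingMetric G U V W hG).deriv, (hasDerivAt_killingMetric G V U W hG).deriv,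
    (hasDerivAt_killingMetric G W U V hG).deriv]
  have e1 : (G.1⁻¹ * W.1 * G.1⁻¹ * U.1 * G.1⁻¹ * V.1).trace =
      (G.1⁻¹ * U.1 * G.1⁻¹ * V.1 * G.1⁻¹ * W.1).trace := by
    rw [show G.1⁻¹ * W.1 * G.1⁻¹ * U.1 * G.1⁻¹ * V.1 =
      (G.1⁻¹ * W.1) * (G.1⁻¹ * U.1 * G.1⁻¹ * V.1) by simp only [Matrix.mul_assoc],
      Matrix.trace_mul_comm]
    simp only [Matrix.mul_assoc]
  have e2 : (G.1⁻¹ * U.1 * G.1⁻¹ * W.1 * G.1⁻¹ * V.1).trace =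
      (G.1⁻¹ * V.1 * G.1⁻¹ * U.1 * G.1⁻¹ * W.1).trace := by
    rw [show G.1⁻¹ * U.1 * G.1⁻¹ * W.1 * G.1⁻¹ * V.1 =
      (G.1⁻¹ * U.1 * G.1⁻¹ * W.1) * (G.1⁻¹ * V.1) by simp only [Matrix.mul_assoc],
      Matrix.trace_mul_comm]
    simp only [Matrix.mul_assoc]
  rw [e1, e2]
  simp only [killingMetric, christoffel]
  simp only [Matrix.mul_neg, Matrix.neg_mul, Matrix.mul_smul, Matrix.smul_mul, Matrix.mul_add,
    Matrix.add_mul, Matrix.trace_neg, Matrix.trace_smul, Matrix.trace_add, Complex.neg_re,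
    Complex.add_re, Complex.real_smul, Complex.re_ofReal_mul, ← Matrix.mul_assoc]
  ring

/-- The Riemannian Hessian `∇²F(U, V) = D²F(U, V) - DF(Γ(U, V))` of a function `F` at `G`, with
respect to `killingMetric`. -/
def riemannianHessian (F : HermMat N → ℝ) (G U V : HermMat N) : ℝ :=
  fderiv ℝ (fderiv ℝ F) G U V - fderiv ℝ F G (christoffel G U V)

end Riemannian

/-! ### The quantized Ding functional -/

section Ding

variable {n : ℕ} {X : Type*} [TopologicalSpace X] [ChartedSpace (Model n) X]
  [IsManifold 𝓘(ℂ, Model n) ω X]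

/-- The metric `FS_k(H)` on `-K_X`, written additively: in the chart `i = (z₁, …, zₙ)` its weight is
`φ = (1 / k) log (k⁻ⁿ sup_{s ≠ 0} |s|² / H(s, s))`, where sections are written as functions by means
of the frame `(∂/∂z₁ ∧ ⋯ ∧ ∂/∂zₙ)^{⊗ k}`; thus `|∂/∂z₁ ∧ ⋯ ∧ ∂/∂zₙ|²_φ = exp (-φ)`. -/
def fubiniStudyWeight {k : ℕ} (H : SesqForm (H0 n X k)) (i : atlas (Model n) X) (x : X) : ℝ :=
  (1 / (k : ℝ)) * Real.log (((k : ℝ) ^ n)⁻¹ *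
    ⨆ s : {s : H0 n X k // s ≠ 0}, ‖coeff i s.1 x‖ ^ 2 / (H s.1 s.1).re)

/-- The canonical volume form `e^{-φ}` of a metric `φ` on `-K_X` with weights `φ i` (`i` a chart):
in a chart it is `(√-1)^{n²} |∂/∂z₁ ∧ ⋯ ∧ ∂/∂zₙ|²_φ dz₁ ∧ ⋯ ∧ dzₙ ∧ dz̄₁ ∧ ⋯ ∧ dz̄ₙ`, which is
`2ⁿ exp (-φ i)` times Lebesgue measure.  As the local measures agree on overlaps, the measure on `X`
they define is their supremum. -/
def canonicalVolume [MeasurableSpace X] (φ : atlas (Model n) X → X → ℝ) :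
    MeasureTheory.Measure X :=
  ⨆ i : atlas (Model n) X,
    (((MeasureTheory.volume : MeasureTheory.Measure (Model n)).restrict i.1.target).withDensity
      fun z => ENNReal.ofReal (2 ^ n * Real.exp (-φ i (i.1.symm z)))).map i.1.symm

/-- The probability measure `μ_φ = e^{-φ} / ∫ e^{-φ}`. -/
def canonicalProbability [MeasurableSpace X] (φ : atlas (Model n) X → X → ℝ) :
    MeasureTheory.Measure X :=
  (canonicalVolume φ Set.univ)⁻¹ • canonicalVolume φ

/-- `𝓛(φ) = - log ∫ e^{-φ}`. -/
def logVolume [MeasurableSpace X] (φ : atlas (Model n) X → X → ℝ) : ℝ :=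
  -Real.log (canonicalVolume φ Set.univ).toReal

/-- The quantized Monge-Ampère energy `-(1 / (k N)) log det (H · Href⁻¹)`, with reference form
`Href`; the determinant is computed in the basis `b`, and does not depend on it. -/
def quantizedEnergy {k N : ℕ} (b : Module.Basis (Fin N) ℂ (H0 n X k))
    (Href H : SesqForm (H0 n X k)) : ℝ :=
  -(1 / ((k : ℝ) * N)) * Real.log (gram b H * (gram b Href)⁻¹).det.re

/-- The quantized Ding functional `𝓓^(k) = -𝓔^(k) + 𝓛 ∘ FS_k`. -/
def quantizedDing [MeasurableSpace X] {k N : ℕ} (b : Module.Basis (Fin N) ℂ (H0 n X k))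
    (Href H : SesqForm (H0 n X k)) : ℝ :=
  -quantizedEnergy b Href H + logVolume (fubiniStudyWeight H)

/-- The quantized Ding functional on the space of hermitian forms on `H⁰(X, -k K_X)`, in the
parametrisation of this space by the cone of positive definite matrices defined by the basis `s`:
the function `g gᴴ ↦ 𝓓^(k)(H_g)`. -/
def dingOnCone [MeasurableSpace X] {k N : ℕ} (s : Module.Basis (Fin N) ℂ (H0 n X k))
    (Href : SesqForm (H0 n X k)) (G : HermMat N) : ℝ :=
  quantizedDing s Href (formOf s G.1)

end Ding

/-! ### Projective space: moment map, vector fields, Fubini-Study metric -/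

section ProjectiveSpace

variable {N : ℕ}

/-- `ℂ^N` with its standard hermitian inner product. -/
abbrev Vec (N : ℕ) : Type := EuclideanSpace ℂ (Fin N)

/-- `ℂℙ^{N-1}`. -/
abbrev CP (N : ℕ) : Type := ℙ ℂ (Vec N)

/-- The matrix `(conj Z_α · Z_β / ∑ |Z_i|²)`. -/
def momentMatrix (Z : Vec N) : Matrix (Fin N) (Fin N) ℂ :=
  Matrix.of fun α β => (starRingEnd ℂ (Z α) * Z β) / (∑ i, (‖Z i‖ : ℂ) ^ 2)

theorem momentMatrix_smul (c : ℂ) (hc : c ≠ 0) (Z : Vec N) :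
    momentMatrix (c • Z) = momentMatrix Z := by
  have h : (starRingEnd ℂ c * c) ≠ 0 := mul_ne_zero (by simpa using hc) hc
  ext α β
  have e : (∑ i, (‖(c • Z) i‖ : ℂ) ^ 2) = (starRingEnd ℂ c * c) * ∑ i, (‖Z i‖ : ℂ) ^ 2 := by
    simp [mul_pow, Finset.mul_sum, ← Complex.conj_mul']
  simp only [momentMatrix, Matrix.of_apply, e]
  rw [← mul_div_mul_left _ (∑ i, (‖Z i‖ : ℂ) ^ 2) h]
  simp only [PiLp.smul_apply, smul_eq_mul, map_mul]
  ring

/-- The map `M : [Z] ↦ (conj Z_α · Z_β / ∑ |Z_i|²)` from `ℂℙ^{N-1}` to hermitian matrices. -/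
def momentMap : CP N → Matrix (Fin N) (Fin N) ℂ :=
  Projectivization.lift (fun Z => momentMatrix Z.1) (by
    rintro ⟨Z, hZ⟩ ⟨W, hW⟩ c (h : Z = c • W)
    have hc : c ≠ 0 := by rintro rfl; exact hZ (by simpa using h)
    simp only [h, momentMatrix_smul c hc])

/-- The function `H(A) = tr (A M)` on `ℂℙ^{N-1}`; it is real valued for hermitian `A`. -/
def hamiltonian (A : HermMat N) (p : CP N) : ℝ := (A.1 * momentMap p).trace.re

/-- The holomorphic tangent space of `ℂℙ^{N-1}` at the line `ℓ`, which is `Hom(ℓ, ℂ^N / ℓ)`.  The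
derivative at `Z ≠ 0` of the projection `ℂ^N ∖ {0} → ℂℙ^{N-1}` maps the tangent vector `w ∈ ℂ^N` to
the homomorphism with `Z ↦ w mod ℓ`. -/
abbrev TangentCP (p : CP N) : Type := p.submodule →ₗ[ℂ] (Vec N ⧸ p.submodule)

/-- The holomorphic vector field `ξ_A` on `ℂℙ^{N-1}`, the image of the linear vector field
`∑ A i j Z_i ∂/∂Z_j`, i.e. `Z ↦ Aᵀ Z`, on `ℂ^N ∖ {0}`. -/
def xi (A : HermMat N) (p : CP N) : TangentCP p :=
  p.submodule.mkQ ∘ₗ (Matrix.toEuclideanLin (A.1ᵀ)) ∘ₗ p.submodule.subtype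

/-- The isomorphism of `ℂ^N / ℓ` with the orthogonal complement of `ℓ`, as a map to `ℂ^N`. -/
def orthLift (p : CP N) : (Vec N ⧸ p.submodule) →ₗ[ℂ] Vec N :=
  p.submodule.liftQ (p.submoduleᗮ.starProjection : Vec N →L[ℂ] Vec N).toLinearMap (by
    intro v hv
    simpa [Submodule.starProjection_orthogonal', sub_eq_zero] using
      (Submodule.starProjection_eq_self_iff.2 hv).symm)

/-- The Fubini-Study hermitian inner product on the holomorphic tangent space at `ℓ`, complex linear
in `η`: on `Hom(ℓ, ℂ^N / ℓ) ≅ Hom(ℓ, ℓᗮ)` it is `⟨η(Z), ζ(Z)⟩ / |Z|²` for any `0 ≠ Z ∈ ℓ`, that is,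
the Kähler metric with components `∂_i ∂_j̄ log |Z|²`. -/
def fsInner (p : CP N) (η ζ : TangentCP p) : ℂ :=
  let Z : p.submodule := ⟨p.rep, by
    rw [Projectivization.submodule_eq]
    exact Submodule.mem_span_singleton_self _⟩
  inner ℂ (orthLift p (ζ Z)) (orthLift p (η Z)) / (‖(Z : Vec N)‖ : ℂ) ^ 2

/-- The Fubini-Study form `ω_FS = (√-1 / 2π) ∂∂̄ log |Z|²`, on real tangent vectors. The real tangent
space is identified with the holomorphic one by `v ↦ (v - √-1 J v) / 2`, so that `J` is
multiplication by `√-1`, and the velocity at `t = 0` of the curve `t ↦ [Z + t w]` is the homomorphism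
with `Z ↦ w mod ℓ`. -/
def fsForm (p : CP N) (u v : TangentCP p) : ℝ := -(1 / Real.pi) * (fsInner p u v).im

/-- The real vector field `ξ_A^ℝ` with `ξ_A = ξ_A^ℝ - √-1 J ξ_A^ℝ`. In the identification of real
with holomorphic tangent vectors made in `fsForm`, it is `ξ_A / 2`. -/
def xiReal (A : HermMat N) (p : CP N) : TangentCP p := (1 / 2 : ℂ) • xi A p

end ProjectiveSpace

/-! ### The embedding defined by a basis of sections -/

section Embedding

variable {n : ℕ} {X : Type*} [TopologicalSpace X] [ChartedSpace (Model n) X]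
  [IsManifold 𝓘(ℂ, Model n) ω X] {k N : ℕ}

/-- The values at `x` of the sections `s₁, …, s_N`, written in a trivialisation of `-k K_X` near
`x`. -/
def homogeneousCoords (s : Module.Basis (Fin N) ℂ (H0 n X k)) (x : X) : Vec N :=
  WithLp.toLp 2 fun j => coeff (achart (Model n) x) (s j) x

theorem coeff_achart (σ : H0 n X k) (x : X) : coeff (achart (Model n) x) σ x = σ x :=
  (anticanonicalCore n X k).coordChange_self (achart (Model n) x) x (mem_chart_source (Model n) x) (σ x)

theorem homogeneousCoords_ne_zero (s : Module.Basis (Fin N) ℂ (H0 n X k))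
    (h : ∀ x : X, ∃ σ : H0 n X k, σ x ≠ 0) (x : X) : homogeneousCoords s x ≠ 0 := by
  intro h0
  obtain ⟨σ, hσ⟩ := h x
  apply hσ
  have hs : ∀ j, (s j) x = 0 := fun j => by
    rw [← coeff_achart]
    exact congrFun (congrArg WithLp.ofLp h0) j
  rw [← s.sum_repr σ]
  have : ∀ t : Finset (Fin N), (∑ i ∈ t, s.repr σ i • s i : H0 n X k) x = 0 := by
    intro t
    induction t using Finset.induction_on with
    | empty => rfl
    | insert a t ha ih =>
      rw [Finset.sum_insert ha, ContMDiffSection.coe_add, Pi.add_apply, ih, add_zero,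
        ContMDiffSection.coe_smul, Pi.smul_apply, hs, smul_zero]
  exact this _

/-- The map `x ↦ [s₁(x) : ⋯ : s_N(x)]` to `ℂℙ^{N-1}`, for a base point free `-k K_X`. -/
def kodairaMap (s : Module.Basis (Fin N) ℂ (H0 n X k))
    (h : ∀ x : X, ∃ σ : H0 n X k, σ x ≠ 0) (x : X) : CP N :=
  Projectivization.mk ℂ (homogeneousCoords s x) (homogeneousCoords_ne_zero s h x)

end Embedding

end

end QuantizedDing

open QuantizedDing

/-!
Let `ν = e^{-FS_k(H₀)}`. The supremum of `|s|² / H(s, s)` over `s` is attained, by Cauchy-Schwarz,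
at a value that is linear in the matrix `G` parametrising `H`; relative to `H₀` it is `H(G)(x)`, so
that `e^{-FS_k(H)} = H(G)^{-1/k} ν`, and `𝓓` is the function
`G ↦ -(k N)⁻¹ log det G + const - log ∫ H(G)^{-1/k} ν` on the cone of positive definite matrices.

The first term is affine along the geodesics `e^{tA}`, hence has vanishing Riemannian Hessian. The
second one is differentiated under the integral sign. With `Γ` the Christoffel symbol at `H₀`, the
identity `Re (ξ_A, ξ_B)_FS = -H(Γ(A, B)) - H(A) H(B)` on `ℂℙ^{N-1}` turns the contribution of the
connection to the Hessian of the integral into its Fubini-Study term.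
-/

namespace QuantizedDing

noncomputable section

open Filter Topology MeasureTheory
open scoped ENNReal

section ProjectiveGeometry

variable {N : ℕ}

/-- The linear vector field `Z ↦ Aᵀ Z` on `ℂ^N`, which induces `ξ_A` on `ℂℙ^{N-1}`. -/
def linearField (A : Matrix (Fin N) (Fin N) ℂ) : Vec N →L[ℂ] Vec N :=
  (Matrix.toEuclideanLin Aᵀ).toContinuousLinearMap

theorem linearField_mul_apply (A B : Matrix (Fin N) (Fin N) ℂ) (Z : Vec N) :
    linearField (A * B) Z = linearField B (linearField A Z) := by
  simp [linearField, Matrix.toLpLin_apply, Matrix.transpose_mul]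

theorem isSymmetric_linearField (A : HermMat N) :
    (linearField A.1 : Vec N →ₗ[ℂ] Vec N).IsSymmetric :=
  Matrix.isSymmetric_toEuclideanLin_iff.2 (Matrix.IsHermitian.transpose A.2)

theorem inner_linearField_self_div (A : HermMat N) (Z : Vec N) :
    inner ℂ (linearField A.1 Z) Z / (‖Z‖ : ℂ) ^ 2 =
      ((linearField A.1).rayleighQuotient Z : ℂ) := by
  rw [ContinuousLinearMap.rayleighQuotient, Complex.ofReal_div, Complex.ofReal_pow]
  exact congrArg (· / _) ((isSymmetric_linearField A).coe_reApplyInnerSelf_apply Z).symm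

theorem inner_self_linearField_div (A : HermMat N) (Z : Vec N) :
    inner ℂ Z (linearField A.1 Z) / (‖Z‖ : ℂ) ^ 2 =
      ((linearField A.1).rayleighQuotient Z : ℂ) := by
  rw [← inner_linearField_self_div]
  exact congrArg (· / _) (isSymmetric_linearField A Z Z).symm

theorem sum_norm_sq_eq (Z : Vec N) : (∑ i, (‖Z i‖ : ℂ) ^ 2) = (‖Z‖ : ℂ) ^ 2 := by
  exact_mod_cast (EuclideanSpace.norm_sq_eq Z).symm

theorem trace_mul_momentMatrix (A : Matrix (Fin N) (Fin N) ℂ) (Z : Vec N) :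
    (A * momentMatrix Z).trace = inner ℂ Z (linearField A Z) / (‖Z‖ : ℂ) ^ 2 := by
  rw [← sum_norm_sq_eq]
  simp only [Matrix.trace, Matrix.diag, Matrix.mul_apply, momentMatrix, Matrix.of_apply,
    linearField, LinearMap.coe_toContinuousLinearMap', PiLp.inner_apply, Matrix.toLpLin_apply,
    Matrix.mulVec, dotProduct, RCLike.inner_apply, Matrix.transpose_apply, Finset.sum_mul,
    Finset.sum_div]
  rw [Finset.sum_comm]
  exact Finset.sum_congr rfl fun i _ => Finset.sum_congr rfl fun j _ => by ring

theorem re_trace_mul_momentMatrix (A : Matrix (Fin N) (Fin N) ℂ) (Z : Vec N) :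
    (A * momentMatrix Z).trace.re = (linearField A).rayleighQuotient Z := by
  rw [trace_mul_momentMatrix, ← Complex.ofReal_pow, Complex.div_ofReal_re,
    ContinuousLinearMap.rayleighQuotient, ContinuousLinearMap.reApplyInnerSelf_apply,
    inner_re_symm]
  rfl

theorem mk_eq_of_mem {p : CP N} {Z : Vec N} (hZ : Z ∈ p.submodule) (h0 : Z ≠ 0) :
    Projectivization.mk ℂ Z h0 = p := by
  rw [Projectivization.submodule_eq, Submodule.mem_span_singleton] at hZ
  rw [← p.mk_rep]
  exact (Projectivization.mk_eq_mk_iff' ℂ _ _ h0 p.rep_nonzero).2 hZ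

theorem hamiltonian_eq_rayleighQuotient (A : HermMat N) {p : CP N} {Z : Vec N}
    (hZ : Z ∈ p.submodule) (h0 : Z ≠ 0) :
    hamiltonian A p = (linearField A.1).rayleighQuotient Z := by
  rw [← mk_eq_of_mem hZ h0]
  exact re_trace_mul_momentMatrix A.1 Z

theorem exists_mem_submodule_ne_zero (p : CP N) : ∃ Z : p.submodule, Z ≠ 0 :=
  ⟨⟨p.rep, p.submodule_eq.ge (Submodule.mem_span_singleton_self _)⟩, fun h =>
    p.rep_nonzero (congrArg Subtype.val h)⟩

theorem fsInner_eq {p : CP N} (η ζ : TangentCP p) {Z : p.submodule} (h0 : Z ≠ 0) :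
    fsInner p η ζ =
      inner ℂ (orthLift p (ζ Z)) (orthLift p (η Z)) / (‖(Z : Vec N)‖ : ℂ) ^ 2 := by
  have hrep : p.rep ∈ p.submodule := p.submodule_eq.ge (Submodule.mem_span_singleton_self _)
  obtain ⟨c, hc⟩ : ∃ c : ℂ, c • (⟨p.rep, hrep⟩ : p.submodule) = Z := by
    obtain ⟨c, hc⟩ := Submodule.mem_span_singleton.1 (p.submodule_eq.le Z.2)
    exact ⟨c, Subtype.ext hc⟩
  have hc0 : (‖c‖ : ℂ) ^ 2 ≠ 0 := by
    rintro h
    obtain rfl : c = 0 := by simpa using h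
    exact h0 (by rw [← hc, zero_smul])
  rw [← hc]
  simp only [fsInner, map_smul, Submodule.coe_smul, norm_smul, inner_smul_left, inner_smul_right,
    Complex.ofReal_mul, mul_pow]
  rw [← mul_assoc, mul_comm c, Complex.conj_mul', mul_div_mul_left _ _ hc0]

theorem inner_orthLift_mkQ (p : CP N) (v w : Vec N) :
    inner ℂ (orthLift p (p.submodule.mkQ v)) (orthLift p (p.submodule.mkQ w)) =
      inner ℂ v (w - p.submodule.starProjection w) := by
  change inner ℂ (p.submoduleᗮ.starProjection v) (p.submoduleᗮ.starProjection w) = _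
  rw [Submodule.inner_starProjection_left_eq_right,
    Submodule.starProjection_eq_self_iff.2 (Submodule.starProjection_apply_mem _ _),
    Submodule.starProjection_orthogonal']
  rfl

theorem fsInner_of_apply_eq_mkQ {p : CP N} {η ζ : TangentCP p} {Z : p.submodule} (h0 : Z ≠ 0)
    {v w : Vec N} (hη : η Z = p.submodule.mkQ v) (hζ : ζ Z = p.submodule.mkQ w) :
    fsInner p η ζ = inner ℂ w v / (‖(Z : Vec N)‖ : ℂ) ^ 2 -
      (inner ℂ w (Z : Vec N) / (‖(Z : Vec N)‖ : ℂ) ^ 2) *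
        (inner ℂ (Z : Vec N) v / (‖(Z : Vec N)‖ : ℂ) ^ 2) := by
  have hspan : p.submodule = ℂ ∙ (Z : Vec N) := by
    rw [← Projectivization.submodule_mk (Z : Vec N) (by simpa using h0), mk_eq_of_mem Z.2]
  have hproj : p.submodule.starProjection v =
      (inner ℂ (Z : Vec N) v / (‖(Z : Vec N)‖ : ℂ) ^ 2) • (Z : Vec N) := by
    simp only [hspan]
    exact_mod_cast Submodule.starProjection_singleton ℂ (v := (Z : Vec N)) v
  rw [fsInner_eq η ζ h0, hη, hζ, inner_orthLift_mkQ, hproj, inner_sub_right, inner_smul_right]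
  ring

theorem xi_apply (A : HermMat N) (p : CP N) (Z : p.submodule) :
    xi A p Z = p.submodule.mkQ (linearField A.1 (Z : Vec N)) := rfl

theorem hamiltonian_christoffel_idHerm (A B : HermMat N) {p : CP N} {Z : Vec N}
    (hZ : Z ∈ p.submodule) (h0 : Z ≠ 0) :
    hamiltonian (christoffel (idHerm N) A B) p =
      -((inner ℂ (linearField B.1 Z) (linearField A.1 Z)).re / ‖Z‖ ^ 2) := by
  have htrace (A B : HermMat N) : ((A.1 * B.1) * momentMatrix Z).trace.re =
      (inner ℂ (linearField B.1 Z) (linearField A.1 Z)).re / ‖Z‖ ^ 2 := by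
    rw [trace_mul_momentMatrix, linearField_mul_apply, ← Complex.ofReal_pow,
      Complex.div_ofReal_re]
    exact congrArg (fun z : ℂ => z.re / ‖Z‖ ^ 2) (isSymmetric_linearField B _ _).symm
  have hsymm : (inner ℂ (linearField A.1 Z) (linearField B.1 Z)).re =
      (inner ℂ (linearField B.1 Z) (linearField A.1 Z)).re := inner_re_symm (𝕜 := ℂ) _ _
  have hΓ : (christoffel (idHerm N) A B).1 = -((1 / 2 : ℝ) • (A.1 * B.1 + B.1 * A.1)) := by
    simp [christoffel, idHerm]
  rw [← mk_eq_of_mem hZ h0]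
  change ((christoffel (idHerm N) A B).1 * momentMatrix Z).trace.re = _
  rw [hΓ, Matrix.neg_mul, Matrix.smul_mul, Matrix.add_mul, Matrix.trace_neg, Matrix.trace_smul,
    Matrix.trace_add, Complex.neg_re, Complex.smul_re, Complex.add_re, htrace, htrace, hsymm,
    smul_eq_mul]
  ring

theorem re_fsInner_xi (A B : HermMat N) (p : CP N) :
    (fsInner p (xi A p) (xi B p)).re =
      -hamiltonian (christoffel (idHerm N) A B) p - hamiltonian A p * hamiltonian B p := by
  obtain ⟨Z, h0⟩ := exists_mem_submodule_ne_zero p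
  have h0' : (Z : Vec N) ≠ 0 := by simpa using h0
  rw [fsInner_of_apply_eq_mkQ h0 (xi_apply A p Z) (xi_apply B p Z), inner_linearField_self_div,
    inner_self_linearField_div, hamiltonian_christoffel_idHerm A B Z.2 h0',
    hamiltonian_eq_rayleighQuotient A Z.2 h0', hamiltonian_eq_rayleighQuotient B Z.2 h0',
    ← Complex.ofReal_pow, ← Complex.ofReal_mul, Complex.sub_re, Complex.div_ofReal_re,
    Complex.ofReal_re, neg_neg, mul_comm (ContinuousLinearMap.rayleighQuotient _ _)]

theorem fsInner_smul_left (p : CP N) (c : ℂ) (η ζ : TangentCP p) :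
    fsInner p (c • η) ζ = c * fsInner p η ζ := by
  simp only [fsInner, LinearMap.smul_apply, map_smul, inner_smul_right, mul_div_assoc]

theorem hasDerivAt_rayleighQuotient_line {E : Type*} [NormedAddCommGroup E]
    [InnerProductSpace ℂ E] {T : E →L[ℂ] E} (hT : (T : E →ₗ[ℂ] E).IsSymmetric) {z : E}
    (hz : z ≠ 0) (w : E) :
    HasDerivAt (fun t : ℝ => T.rayleighQuotient (z + t • w))
      (2 * ((inner ℂ w (T z)).re / ‖z‖ ^ 2
        - (inner ℂ w z).re / ‖z‖ ^ 2 * T.rayleighQuotient z)) 0 := by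
  have hline : HasDerivAt (fun t : ℝ => z + t • w) w 0 := by
    simpa using ((hasDerivAt_id (0 : ℝ)).smul_const w).const_add z
  have hself {S : E →L[ℂ] E} (hS : (S : E →ₗ[ℂ] E).IsSymmetric) :
      HasDerivAt (fun t : ℝ => S.reApplyInnerSelf (z + t • w)) (2 * (inner ℂ w (S z)).re) 0 := by
    have hSline : HasDerivAt (fun t : ℝ => S (z + t • w)) (S w) 0 :=
      (S.restrictScalars ℝ).hasFDerivAt.comp_hasDerivAt (0 : ℝ) hline
    refine (Complex.reCLM.hasFDerivAt.comp_hasDerivAt (0 : ℝ)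
      (hSline.inner ℂ hline)).congr_deriv ?_
    have h1 : inner ℂ (S w) z = inner ℂ w (S z) := hS w z
    have h2 : (inner ℂ (S z) w).re = (inner ℂ w (S z)).re := inner_re_symm (𝕜 := ℂ) _ _
    rw [zero_smul, add_zero, Complex.reCLM_apply, Complex.add_re, h1, h2]
    ring
  have hnorm : HasDerivAt (fun t : ℝ => ‖z + t • w‖ ^ 2) (2 * (inner ℂ w z).re) 0 := by
    have h := hself (S := .id ℂ E) fun _ _ => rfl
    simpa only [ContinuousLinearMap.reApplyInnerSelf_apply, ContinuousLinearMap.id_apply,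
      inner_self_eq_norm_sq] using h
  have hz' : ‖z‖ ≠ 0 := norm_ne_zero_iff.2 hz
  refine ((hself hT).div hnorm (by simpa using hz)).congr_deriv ?_
  rw [zero_smul, add_zero, ContinuousLinearMap.rayleighQuotient]
  field_simp

theorem fsForm_I_smul_xiReal (A : HermMat N) {p : CP N} {Z : p.submodule} (h0 : Z ≠ 0) {w : Vec N}
    {η : TangentCP p} (hη : η Z = p.submodule.mkQ w) :
    fsForm p (Complex.I • xiReal A p) η = -(1 / (2 * Real.pi)) *
      ((inner ℂ w (linearField A.1 (Z : Vec N))).re / ‖(Z : Vec N)‖ ^ 2 -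
        (inner ℂ w (Z : Vec N)).re / ‖(Z : Vec N)‖ ^ 2 *
          (linearField A.1).rayleighQuotient (Z : Vec N)) := by
  rw [fsForm, xiReal, fsInner_smul_left, fsInner_smul_left,
    fsInner_of_apply_eq_mkQ h0 (xi_apply A p Z) hη, inner_self_linearField_div,
    Complex.I_mul_im, show (1 / 2 : ℂ) = ((1 / 2 : ℝ) : ℂ) by push_cast; rfl,
    Complex.re_ofReal_mul, Complex.sub_re, Complex.re_mul_ofReal, ← Complex.ofReal_pow,
    Complex.div_ofReal_re, Complex.div_ofReal_re]
  field_simp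

theorem hasDerivAt_re_trace_mul_momentMatrix (A : HermMat N) {p : CP N} {Z : p.submodule}
    (h0 : Z ≠ 0) {w : Vec N} {η : TangentCP p} (hη : η Z = p.submodule.mkQ w) :
    HasDerivAt (fun t : ℝ => (A.1 * momentMatrix ((Z : Vec N) + t • w)).trace.re)
      (-(4 * Real.pi) * fsForm p (Complex.I • xiReal A p) η) 0 := by
  simp only [re_trace_mul_momentMatrix]
  refine (hasDerivAt_rayleighQuotient_line (isSymmetric_linearField A) (by simpa using h0)
    w).congr_deriv ?_
  rw [fsForm_I_smul_xiReal A h0 hη]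
  field_simp
  ring

end ProjectiveGeometry

section PowerIntegral

universe u v

open Function Set in
theorem isOpen_setOf_forall_mem {X Y Z : Type*} [TopologicalSpace X] [CompactSpace X]
    [TopologicalSpace Y] [TopologicalSpace Z] {f : Y → X → Z} (hf : Continuous (uncurry f))
    {s : Set Z} (hs : IsOpen s) : IsOpen {y | ∀ x, f y x ∈ s} := by
  refine isOpen_iff_mem_nhds.2 fun y hy => ?_
  have h : ∀ᶠ y' in 𝓝 y, ∀ x ∈ (univ : Set X), f y' x ∈ s :=
    isCompact_univ.eventually_forall_of_forall_eventually fun x _ =>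
      hf.continuousAt.eventually_mem (hs.mem_nhds (hy x))
  exact h.mono fun y' h' x => h' x (mem_univ x)

variable {X : Type*} [TopologicalSpace X]
  {E F : Type*} [NormedAddCommGroup E] [NormedSpace ℝ E] [NormedAddCommGroup F] [NormedSpace ℝ F]
  {L : X → E →L[ℝ] ℝ}

theorem continuous_smulRight (hL : Continuous L) {c : X → F} (hc : Continuous c) :
    Continuous fun x => (L x).smulRight (c x) :=
  (ContinuousLinearMap.smulRightL ℝ E F).continuous₂.comp (hL.prodMk hc)

variable [CompactSpace X]

theorem isOpen_setOf_forall_apply_pos (hL : Continuous L) : IsOpen {G | ∀ x, 0 < L x G} :=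
  isOpen_setOf_forall_mem (f := fun G x => L x G)
    ((hL.comp continuous_snd).clm_apply continuous_fst) isOpen_Ioi

variable [MeasurableSpace X] [OpensMeasurableSpace X] {ν : Measure X} [IsFiniteMeasure ν]

theorem integrable_of_continuous {F : Type*} [NormedAddCommGroup F] {f : X → F}
    (hf : Continuous f) : Integrable f ν :=
  hf.integrable_of_hasCompactSupport (.of_compactSpace f)

open Function Set in
theorem hasFDerivAt_integral_of_continuousOn {f : E → X → F} {f' : E → X → E →L[ℝ] F} {S : Set E}
    (hS : IsOpen S) (hf : ∀ G ∈ S, Continuous (f G)) (hf' : ContinuousOn (uncurry f') (S ×ˢ univ))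
    (hd : ∀ G ∈ S, ∀ x, HasFDerivAt (f · x) (f' G x) G) {G : E} (hG : G ∈ S) :
    HasFDerivAt (fun G => ∫ x, f G x ∂ν) (∫ x, f' G x ∂ν) G := by
  have hf'G : Continuous (f' G) :=
    hf'.comp_continuous (Continuous.prodMk_right G) fun x => ⟨hG, mem_univ x⟩
  obtain ⟨C, hC⟩ := isCompact_univ.exists_bound_of_continuousOn hf'G.continuousOn
  have hbound : ∀ᶠ G' in 𝓝 G, ∀ x ∈ (univ : Set X), ‖f' G' x‖ < C + 1 :=
    isCompact_univ.eventually_forall_of_forall_eventually fun x _ =>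
      (hf'.continuousAt ((hS.prod isOpen_univ).mem_nhds ⟨hG, mem_univ x⟩)).norm.eventually_lt
        continuousAt_const ((hC x (mem_univ x)).trans_lt (lt_add_one C))
  exact hasFDerivAt_integral_of_dominated_of_fderiv_le
    (hbound.and (hS.eventually_mem hG))
    ((hS.eventually_mem hG).mono fun G' hG' => (integrable_of_continuous (hf G' hG')).1)
    (integrable_of_continuous (hf G hG)) (integrable_of_continuous hf'G).1
    (.of_forall fun x G' hG' => (hG'.1 x (mem_univ x)).le) (integrable_const (C + 1))
    (.of_forall fun x G' hG' => hd G' hG'.2 x)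

/-- The integral `∫ (L x G)^r • c x dν` of a power of a linear function of the parameter `G`. Its
derivative in `G` is again of this form, with values in a space of linear maps. -/
def powerIntegral {X : Type*} [MeasurableSpace X] (ν : Measure X) (L : X → E →L[ℝ] ℝ) (r : ℝ)
    (c : X → F) (G : E) : F :=
  ∫ x, (L x G) ^ r • c x ∂ν

theorem hasFDerivAt_powerIntegral (hL : Continuous L) {c : X → F} (hc : Continuous c) (r : ℝ)
    {G : E} (hG : ∀ x, 0 < L x G) :
    HasFDerivAt (powerIntegral ν L r c)
      (r • powerIntegral ν L (r - 1) (fun x => (L x).smulRight (c x)) G) G := by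
  have hLc : Continuous fun p : E × X => L p.2 p.1 :=
    (hL.comp continuous_snd).clm_apply continuous_fst
  rw [powerIntegral, ← integral_smul]
  refine hasFDerivAt_integral_of_continuousOn (S := {G | ∀ x, 0 < L x G})
    (f' := fun G x => r • ((L x G) ^ (r - 1) • (L x).smulRight (c x)))
    (isOpen_setOf_forall_apply_pos hL) (fun G hG => ?_) ?_ (fun G hG x => ?_) hG
  · exact ((hL.clm_apply continuous_const).rpow_const fun x => .inl (hG x).ne').smul hc
  · exact ((hLc.continuousOn.rpow_const fun p hp => .inl (hp.1 p.2).ne').smul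
      ((continuous_smulRight hL hc).comp continuous_snd).continuousOn).const_smul r
  · refine (((L x).hasFDerivAt.rpow_const (.inl (hG x).ne')).smul_const (c x)).congr_fderiv ?_
    ext v
    simp [smul_smul, mul_assoc]

theorem contDiffOn_powerIntegral_succ (hL : Continuous L) {c : X → F} (hc : Continuous c)
    (r : ℝ) {m : ℕ} (h : ContDiffOn ℝ m
      (powerIntegral ν L (r - 1) fun x => (L x).smulRight (c x)) {G | ∀ x, 0 < L x G}) :
    ContDiffOn ℝ (m + 1) (powerIntegral ν L r c) {G | ∀ x, 0 < L x G} := by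
  have hd (G : E) (hG : ∀ x, 0 < L x G) := hasFDerivAt_powerIntegral (ν := ν) hL hc r hG
  rw [contDiffOn_succ_iff_fderiv_of_isOpen (isOpen_setOf_forall_apply_pos hL)]
  exact ⟨fun G hG => (hd G hG).differentiableAt.differentiableWithinAt, by simp,
    (h.const_smul r).congr fun G hG => (hd G hG).fderiv⟩

theorem contDiffOn_powerIntegral_zero (hL : Continuous L) {c : X → F} (hc : Continuous c)
    (r : ℝ) : ContDiffOn ℝ 0 (powerIntegral ν L r c) {G | ∀ x, 0 < L x G} :=
  contDiffOn_zero.2 fun _ hG =>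
    (hasFDerivAt_powerIntegral hL hc r hG).continuousAt.continuousWithinAt

-- The induction passes from `F` to `E →L[ℝ] F`, so it needs a universe closed under this operation.
theorem contDiffOn_powerIntegral_of_univ {E : Type u} [NormedAddCommGroup E] [NormedSpace ℝ E]
    {L : X → E →L[ℝ] ℝ} (hL : Continuous L) (m : ℕ) {F : Type (max u v)} [NormedAddCommGroup F]
    [NormedSpace ℝ F] {c : X → F} (hc : Continuous c) (r : ℝ) :
    ContDiffOn ℝ m (powerIntegral ν L r c) {G | ∀ x, 0 < L x G} := by
  induction m generalizing F r with
  | zero => exact contDiffOn_powerIntegral_zero hL hc r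
  | succ m ih =>
    exact contDiffOn_powerIntegral_succ hL hc r (ih (continuous_smulRight hL hc) (r - 1))

theorem contDiffOn_powerIntegral {E : Type u} [NormedAddCommGroup E] [NormedSpace ℝ E]
    {L : X → E →L[ℝ] ℝ} (hL : Continuous L) (m : ℕ) {F : Type v} [NormedAddCommGroup F]
    [NormedSpace ℝ F] {c : X → F} (hc : Continuous c) (r : ℝ) :
    ContDiffOn ℝ m (powerIntegral ν L r c) {G | ∀ x, 0 < L x G} := by
  cases m with
  | zero => exact contDiffOn_powerIntegral_zero hL hc r
  | succ m =>
    exact contDiffOn_powerIntegral_succ hL hc r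
      (contDiffOn_powerIntegral_of_univ.{u, v} hL m (continuous_smulRight hL hc) (r - 1))

theorem contDiffAt_powerIntegral (hL : Continuous L) (m : ℕ) {c : X → F} (hc : Continuous c)
    (r : ℝ) {G : E} (hG : ∀ x, 0 < L x G) : ContDiffAt ℝ m (powerIntegral ν L r c) G :=
  (contDiffOn_powerIntegral hL m hc r).contDiffAt
    ((isOpen_setOf_forall_apply_pos hL).mem_nhds hG)

theorem fderiv_powerIntegral_apply [CompleteSpace F] (hL : Continuous L) {c : X → F}
    (hc : Continuous c) (r : ℝ) {G : E} (hG : ∀ x, 0 < L x G) (V : E) :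
    fderiv ℝ (powerIntegral ν L r c) G V = r • ∫ x, (L x G) ^ (r - 1) • L x V • c x ∂ν := by
  have hint : Integrable (fun x => (L x G) ^ (r - 1) • (L x).smulRight (c x)) ν :=
    integrable_of_continuous (((hL.clm_apply continuous_const).rpow_const
      fun x => .inl (hG x).ne').smul (continuous_smulRight hL hc))
  rw [(hasFDerivAt_powerIntegral hL hc r hG).fderiv, smul_apply, powerIntegral,
    ContinuousLinearMap.integral_apply hint]
  rfl

theorem fderiv_fderiv_powerIntegral_apply [CompleteSpace F] (hL : Continuous L) {c : X → F}
    (hc : Continuous c) (r : ℝ) {G : E} (hG : ∀ x, 0 < L x G) (U V : E) :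
    fderiv ℝ (fderiv ℝ (powerIntegral ν L r c)) G U V =
      (r * (r - 1)) • ∫ x, (L x G) ^ (r - 2) • L x U • L x V • c x ∂ν := by
  have hev : fderiv ℝ (powerIntegral ν L r c) =ᶠ[𝓝 G]
      fun G => r • powerIntegral ν L (r - 1) (fun x => (L x).smulRight (c x)) G :=
    ((isOpen_setOf_forall_apply_pos hL).eventually_mem hG).mono fun G' hG' =>
      (hasFDerivAt_powerIntegral hL hc r hG').fderiv
  have hc' := continuous_smulRight hL hc
  have hd := hasFDerivAt_powerIntegral (ν := ν) hL hc' (r - 1) hG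
  have hint : Integrable (fun x => (L x G) ^ (r - 2) • L x U • (L x).smulRight (c x)) ν :=
    integrable_of_continuous (((hL.clm_apply continuous_const).rpow_const
      fun x => .inl (hG x).ne').smul ((hL.clm_apply continuous_const).smul hc'))
  rw [hev.fderiv_eq, fderiv_fun_const_smul hd.differentiableAt, smul_apply, smul_apply,
    fderiv_powerIntegral_apply hL hc' (r - 1) hG, smul_apply, ← mul_smul,
    show r - 1 - 1 = r - 2 by ring, ContinuousLinearMap.integral_apply hint]
  rfl

end PowerIntegral

section CovariantHessian

section General

variable {E : Type*} [NormedAddCommGroup E] [NormedSpace ℝ E] {F F' f : E → ℝ} {G : E}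

/-- The value at `(U, V)` of the Hessian at `G` with respect to a torsion-free connection, where
`Γ` is the covariant derivative `∇_U V` at `G` of the constant vector field `V`. -/
def covariantHessian (F : E → ℝ) (G Γ U V : E) : ℝ :=
  fderiv ℝ (fderiv ℝ F) G U V - fderiv ℝ F G Γ

theorem covariantHessian_congr (h : F =ᶠ[𝓝 G] F') (Γ U V : E) :
    covariantHessian F G Γ U V = covariantHessian F' G Γ U V := by
  rw [covariantHessian, covariantHessian, h.fderiv.fderiv_eq, h.fderiv_eq]

theorem eventually_differentiableAt_of_contDiffAt_two (hF : ContDiffAt ℝ 2 F G) :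
    ∀ᶠ G' in 𝓝 G, DifferentiableAt ℝ F G' :=
  (hF.eventually (by simp)).mono fun _ h => h.differentiableAt (by simp)

theorem differentiableAt_fderiv_of_contDiffAt_two (hF : ContDiffAt ℝ 2 F G) :
    DifferentiableAt ℝ (fderiv ℝ F) G :=
  (hF.fderiv_right (m := 1) (by norm_num)).differentiableAt (by simp)

theorem covariantHessian_add (hF : ContDiffAt ℝ 2 F G) (hF' : ContDiffAt ℝ 2 F' G) (Γ U V : E) :
    covariantHessian (fun G => F G + F' G) G Γ U V =
      covariantHessian F G Γ U V + covariantHessian F' G Γ U V := by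
  have h : fderiv ℝ (fun G => F G + F' G) =ᶠ[𝓝 G] fun G => fderiv ℝ F G + fderiv ℝ F' G := by
    filter_upwards [eventually_differentiableAt_of_contDiffAt_two hF,
      eventually_differentiableAt_of_contDiffAt_two hF'] with G' h h'
    exact fderiv_fun_add h h'
  rw [covariantHessian, h.fderiv_eq, h.eq_of_nhds,
    fderiv_fun_add (differentiableAt_fderiv_of_contDiffAt_two hF)
      (differentiableAt_fderiv_of_contDiffAt_two hF')]
  simp only [add_apply, covariantHessian]
  ring

theorem covariantHessian_const_mul_add (F : E → ℝ) (c d : ℝ) (G Γ U V : E) :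
    covariantHessian (fun G => c * F G + d) G Γ U V = c * covariantHessian F G Γ U V := by
  have h : fderiv ℝ (fun G => c * F G + d) = c • fderiv ℝ F := by
    funext G'
    rw [fderiv_add_const]
    exact congrFun (fderiv_const_smul_field (𝕜 := ℝ) (f := F) c) G'
  have h' : fderiv ℝ (c • fderiv ℝ F) = c • fderiv ℝ (fderiv ℝ F) :=
    fderiv_const_smul_field (f := fderiv ℝ F) c
  rw [covariantHessian, h, h', covariantHessian, mul_sub]
  rfl

theorem covariantHessian_neg_log (hf : ContDiffAt ℝ 2 f G) (h0 : f G ≠ 0) (Γ U V : E) :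
    covariantHessian (fun G => -Real.log (f G)) G Γ U V =
      (f G)⁻¹ * fderiv ℝ f G U * ((f G)⁻¹ * fderiv ℝ f G V) -
        (f G)⁻¹ * covariantHessian f G Γ U V := by
  have h : (fderiv ℝ fun G => -Real.log (f G)) =ᶠ[𝓝 G] fun G => -((f G)⁻¹ • fderiv ℝ f G) := by
    filter_upwards [hf.continuousAt.eventually_ne h0,
      eventually_differentiableAt_of_contDiffAt_two hf] with G' h1 h2
    exact (h2.hasFDerivAt.log h1).neg.fderiv
  have hd : HasFDerivAt (fun G => -((f G)⁻¹ • fderiv ℝ f G)) _ G :=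
    (((hasDerivAt_inv h0).comp_hasFDerivAt G (hf.differentiableAt (by simp)).hasFDerivAt).smul
      (differentiableAt_fderiv_of_contDiffAt_two hf).hasFDerivAt).neg
  rw [covariantHessian, h.fderiv_eq, h.eq_of_nhds, hd.fderiv, covariantHessian]
  simp only [Function.comp_apply, neg_smul, neg_add_rev, add_apply, neg_apply,
    ContinuousLinearMap.smulRight_apply, smul_apply, smul_eq_mul, neg_neg, sub_neg_eq_add]
  ring

end General

theorem powerIntegral_one_of_apply_eq_one {X : Type*} [MeasurableSpace X] {ν : Measure X}
    {E : Type*} [NormedAddCommGroup E] [NormedSpace ℝ E] {L : X → E →L[ℝ] ℝ} {G : E}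
    (hG : ∀ x, L x G = 1) (r : ℝ) : powerIntegral ν L r (1 : X → ℝ) G = ν.real Set.univ := by
  simp [powerIntegral, hG]

variable {X : Type*} [TopologicalSpace X] [CompactSpace X] [MeasurableSpace X]
  [OpensMeasurableSpace X] {ν : Measure X} [IsFiniteMeasure ν]
  {E : Type*} [NormedAddCommGroup E] [NormedSpace ℝ E] {L : X → E →L[ℝ] ℝ} {G : E}

theorem contDiffAt_neg_log_powerIntegral [NeZero ν] (hL : Continuous L) (r : ℝ) (m : ℕ)
    (hG : ∀ x, L x G = 1) :
    ContDiffAt ℝ m (fun G => -Real.log (powerIntegral ν L r (1 : X → ℝ) G)) G := by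
  refine ((contDiffAt_powerIntegral hL m continuous_one r fun x => ?_).log ?_).neg
  · exact (hG x).symm ▸ one_pos
  · rw [powerIntegral_one_of_apply_eq_one hG r]
    exact measureReal_univ_ne_zero

theorem covariantHessian_neg_log_powerIntegral [NeZero ν] (hL : Continuous L) (r : ℝ)
    (hG : ∀ x, L x G = 1) (Γ U V : E) :
    covariantHessian (fun G => -Real.log (powerIntegral ν L r (1 : X → ℝ) G)) G Γ U V =
      r * (⨍ x, L x Γ ∂ν) - r * (r - 1) * (⨍ x, L x U * L x V ∂ν) +
        r ^ 2 * (⨍ x, L x U ∂ν) * ⨍ x, L x V ∂ν := by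
  have hpos (x : X) : 0 < L x G := (hG x).symm ▸ one_pos
  have hfirst (W : E) : fderiv ℝ (powerIntegral ν L r (1 : X → ℝ)) G W = r * ∫ x, L x W ∂ν := by
    simp [fderiv_powerIntegral_apply hL continuous_one r hpos, hG]
  have hsecond : fderiv ℝ (fderiv ℝ (powerIntegral ν L r (1 : X → ℝ))) G U V =
      r * (r - 1) * ∫ x, L x U * L x V ∂ν := by
    simp [fderiv_fderiv_powerIntegral_apply hL continuous_one r hpos, hG]
  have hne : powerIntegral ν L r (1 : X → ℝ) G ≠ 0 := by
    rw [powerIntegral_one_of_apply_eq_one hG r]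
    exact measureReal_univ_ne_zero
  rw [covariantHessian_neg_log (contDiffAt_powerIntegral hL 2 continuous_one r hpos) hne,
    covariantHessian, hfirst, hfirst, hfirst, hsecond, powerIntegral_one_of_apply_eq_one hG r]
  simp only [average_eq, smul_eq_mul]
  ring

end CovariantHessian

section LogDet

theorem hasDerivAt_det_one_add_smul {𝕜 m : Type*} [NontriviallyNormedField 𝕜] [Fintype m]
    [DecidableEq m] (A : Matrix m m 𝕜) :
    HasDerivAt (fun z : 𝕜 => (1 + z • A).det) A.trace 0 := by
  have heval (z : 𝕜) : (1 + z • A).det =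
      (1 + (Polynomial.X : Polynomial 𝕜) • A.map Polynomial.C).det.eval z := by
    rw [← Polynomial.coe_evalRingHom, RingHom.map_det]
    congr 1
    ext i j
    simp [Matrix.one_apply, apply_ite (Polynomial.eval z), mul_comm z]
  simp only [heval]
  rw [← Matrix.derivative_det_one_add_X_smul]
  exact Polynomial.hasDerivAt _ _

theorem hasDerivAt_apply_inverse_add_smul_mul {R : Type*} [NormedRing R] [NormedAlgebra ℝ R]
    [FiniteDimensional ℝ R] (T : R →ₗ[ℝ] ℝ) (u : Rˣ) (b c : R) :
    HasDerivAt (fun t : ℝ => T (Ring.inverse (u + t • b) * c))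
      (-T (Ring.inverse ↑u * b * Ring.inverse ↑u * c)) 0 := by
  have : CompleteSpace R := FiniteDimensional.complete ℝ R
  have hline : HasDerivAt (fun t : ℝ => (u : R) + t • b) b 0 := by
    simpa using ((hasDerivAt_id (0 : ℝ)).smul_const b).const_add (u : R)
  have hinv : HasFDerivAt Ring.inverse (-ContinuousLinearMap.mulLeftRight ℝ R ↑u⁻¹ ↑u⁻¹)
      ((u : R) + (0 : ℝ) • b) := by
    simpa using hasFDerivAt_ringInverse (𝕜 := ℝ) u
  refine (T.toContinuousLinearMap.hasFDerivAt.comp_hasDerivAt (0 : ℝ)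
    ((hinv.comp_hasDerivAt (0 : ℝ) hline).mul_const c)).congr_deriv ?_
  simp

theorem hasDerivAt_re_trace_inv_add_smul_mul {m : Type*} [Fintype m] [DecidableEq m]
    {A : Matrix m m ℂ} (hA : IsUnit A.det) (B C : Matrix m m ℂ) :
    HasDerivAt (fun t : ℝ => ((A + t • B)⁻¹ * C).trace.re) (-(A⁻¹ * B * A⁻¹ * C).trace.re) 0 := by
  obtain ⟨u, rfl⟩ := (Matrix.isUnit_iff_isUnit_det A).2 hA
  simp only [Matrix.nonsing_inv_eq_ringInverse]
  exact hasDerivAt_apply_inverse_add_smul_mul (Complex.reLm ∘ₗ Matrix.traceLinearMap m ℝ ℂ) u B C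

variable {m : Type*} [Fintype m] [DecidableEq m] {E : Type*} [NormedAddCommGroup E]
  [NormedSpace ℝ E] {G : E} (M : E →ₗ[ℝ] Matrix m m ℂ)

theorem ofReal_re_det {A : Matrix m m ℂ} (hA : A.IsHermitian) : (A.det.re : ℂ) = A.det := by
  rw [← Complex.conj_eq_iff_re, starRingEnd_apply, ← Matrix.det_conjTranspose, hA]

theorem re_det_ne_zero {A : Matrix m m ℂ} (hA : A.IsHermitian) (h0 : A.det ≠ 0) : A.det.re ≠ 0 :=
  fun h => h0 (by rw [← ofReal_re_det hA, h, Complex.ofReal_zero])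

theorem contDiff_re_det [FiniteDimensional ℝ E] : ContDiff ℝ ω fun G => (M G).det.re := by
  have h (i j : m) : ContDiff ℝ ω fun G => M G i j :=
    ((Matrix.entryLinearMap ℝ ℂ i j).comp M).toContinuousLinearMap.contDiff
  refine Complex.reCLM.contDiff.comp (g := Complex.re) ?_
  simp only [Matrix.det_apply']
  exact ContDiff.sum fun σ _ => contDiff_const.mul (contDiff_prod fun i _ => h _ _)

variable (hM : ∀ G, (M G).IsHermitian)
include hM

theorem contDiffAt_log_det [FiniteDimensional ℝ E] (hG : (M G).det ≠ 0) :
    ContDiffAt ℝ ω (fun G => Real.log (M G).det.re) G :=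
  (contDiff_re_det M).contDiffAt.log (re_det_ne_zero (hM G) hG)

theorem fderiv_log_det [FiniteDimensional ℝ E] (hG : (M G).det ≠ 0) (V : E) :
    fderiv ℝ (fun G => Real.log (M G).det.re) G V = ((M G)⁻¹ * M V).trace.re := by
  have hre := re_det_ne_zero (hM G) hG
  have hline (t : ℝ) : (M (G + t • V)).det.re =
      (M G).det.re * (1 + (t : ℂ) • ((M G)⁻¹ * M V)).det.re := by
    rw [← Complex.re_ofReal_mul, ofReal_re_det (hM G), ← Matrix.det_mul, Matrix.mul_add,
      Matrix.mul_one, Matrix.mul_smul, Matrix.mul_nonsing_inv_cancel_left _ _ hG.isUnit,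
      Complex.coe_smul, map_add, map_smul]
  have hdet : HasDerivAt (fun t : ℝ => (M (G + t • V)).det.re)
      ((M G).det.re * ((M G)⁻¹ * M V).trace.re) 0 := by
    simp only [hline]
    exact (HasDerivAt.real_of_complex (z := 0) (hasDerivAt_det_one_add_smul _)).const_mul _
  have hlog := hdet.log (by simpa using hre)
  rw [← ((contDiffAt_log_det M hM hG).differentiableAt (by simp)).lineDeriv_eq_fderiv]
  refine HasDerivAt.deriv (hlog.congr_deriv ?_)
  rw [zero_smul, add_zero, mul_div_cancel_left₀ _ hre]

theorem fderiv_fderiv_log_det [FiniteDimensional ℝ E] (hG : (M G).det ≠ 0) (U V : E) :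
    fderiv ℝ (fderiv ℝ fun G => Real.log (M G).det.re) G U V =
      -((M G)⁻¹ * M U * (M G)⁻¹ * M V).trace.re := by
  have hd : DifferentiableAt ℝ (fderiv ℝ fun G => Real.log (M G).det.re) G :=
    differentiableAt_fderiv_of_contDiffAt_two ((contDiffAt_log_det M hM hG).of_le le_top)
  have h1 := ((ContinuousLinearMap.apply ℝ ℝ V).hasFDerivAt.comp G
    hd.hasFDerivAt).hasLineDerivAt U
  have hne : ∀ᶠ t in 𝓝 (0 : ℝ), (M (G + t • U)).det ≠ 0 := by
    have hline : Continuous fun t : ℝ => (M (G + t • U)).det.re :=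
      (contDiff_re_det M).continuous.comp (by fun_prop)
    have hre : (M (G + (0 : ℝ) • U)).det.re ≠ 0 := by
      simpa using re_det_ne_zero (hM G) hG
    exact (hline.continuousAt.eventually_ne hre).mono fun t ht h => ht (by rw [h, Complex.zero_re])
  have h2 := hasDerivAt_re_trace_inv_add_smul_mul hG.isUnit (M U) (M V)
  refine h1.unique (h2.congr_of_eventuallyEq ?_)
  filter_upwards [hne] with t ht
  simpa using fderiv_log_det M hM ht V

omit hM

theorem contDiffAt_log_det_hermMat {N : ℕ} {G : HermMat N} (hG : G.1.det ≠ 0) :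
    ContDiffAt ℝ ω (fun G : HermMat N => Real.log G.1.det.re) G :=
  contDiffAt_log_det (E := HermMat N) (Submodule.subtype _) Subtype.property hG

theorem covariantHessian_log_det {N : ℕ} {G : HermMat N} (hG : G.1.det ≠ 0) (U V : HermMat N) :
    covariantHessian (fun G : HermMat N => Real.log G.1.det.re) G (christoffel G U V) U V = 0 := by
  have hfirst : fderiv ℝ (fun G : HermMat N => Real.log G.1.det.re) G (christoffel G U V) =
      (G.1⁻¹ * (christoffel G U V).1).trace.re :=
    fderiv_log_det (E := HermMat N) (Submodule.subtype _) Subtype.property hG _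
  have hsecond : fderiv ℝ (fderiv ℝ fun G : HermMat N => Real.log G.1.det.re) G U V =
      -(G.1⁻¹ * U.1 * G.1⁻¹ * V.1).trace.re :=
    fderiv_fderiv_log_det (E := HermMat N) (Submodule.subtype _) Subtype.property hG U V
  have hsymm : (G.1⁻¹ * V.1 * G.1⁻¹ * U.1).trace = (G.1⁻¹ * U.1 * G.1⁻¹ * V.1).trace := by
    rw [Matrix.mul_assoc, Matrix.trace_mul_comm, ← Matrix.mul_assoc]
  have hΓ : (christoffel G U V).1 = -((1 / 2 : ℝ) • (U.1 * G.1⁻¹ * V.1 + V.1 * G.1⁻¹ * U.1)) := rfl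
  refine (congrArg₂ (· - ·) hsecond hfirst).trans ?_
  simp only [hΓ, Matrix.mul_neg, Matrix.mul_smul, Matrix.mul_add, Matrix.trace_neg,
    Matrix.trace_smul, Matrix.trace_add, ← Matrix.mul_assoc, hsymm, Complex.neg_re,
    Complex.smul_re, Complex.add_re, smul_eq_mul]
  ring

end LogDet

section PositiveDefinite

open scoped ComplexOrder

theorem re_dotProduct_mulVec_pos {m : Type*} [Fintype m] {G : Matrix m m ℂ} (hG : G.PosDef)
    {v : m → ℂ} (hv : v ≠ 0) : 0 < (star v ⬝ᵥ (G *ᵥ v)).re :=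
  (Complex.pos_iff.1 (hG.dotProduct_mulVec_pos hv)).1

theorem posDef_iff_forall_sphere {m : Type*} [Fintype m] {G : Matrix m m ℂ} (hG : G.IsHermitian) :
    G.PosDef ↔ ∀ v : Metric.sphere (0 : m → ℂ) 1, 0 < (star v.1 ⬝ᵥ (G *ᵥ v.1)).re := by
  refine ⟨fun h v => re_dotProduct_mulVec_pos h (ne_zero_of_mem_unit_sphere v), fun h => ?_⟩
  refine Matrix.PosDef.of_dotProduct_mulVec_pos hG fun v hv => Complex.pos_iff.2
    ⟨?_, (hG.im_star_dotProduct_mulVec_self v).symm⟩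
  have hunit : (‖v‖⁻¹ : ℝ) • v ∈ Metric.sphere (0 : m → ℂ) 1 := by
    rw [mem_sphere_zero_iff_norm]
    exact norm_smul_inv_norm (𝕜 := ℝ) hv
  have hpos := h ⟨_, hunit⟩
  simp only [Matrix.mulVec_smul, star_smul, star_trivial, smul_dotProduct, dotProduct_smul,
    Complex.smul_re, smul_eq_mul] at hpos
  exact pos_of_mul_pos_right (pos_of_mul_pos_right hpos (by positivity)) (by positivity)

variable {N : ℕ}

theorem isOpen_setOf_posDef : IsOpen {G : HermMat N | G.1.PosDef} := by
  have h : {G : HermMat N | G.1.PosDef} = {G : HermMat N |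
      ∀ v : Metric.sphere (0 : Fin N → ℂ) 1, (star v.1 ⬝ᵥ (G.1 *ᵥ v.1)).re ∈ Set.Ioi 0} :=
    Set.ext fun G => posDef_iff_forall_sphere G.2
  rw [h]
  refine isOpen_setOf_forall_mem (f := fun (G : HermMat N) (v : Metric.sphere (0 : Fin N → ℂ) 1) =>
    (star v.1 ⬝ᵥ (G.1 *ᵥ v.1)).re) (Complex.continuous_re.comp ?_) isOpen_Ioi
  have hv : Continuous fun p : HermMat N × Metric.sphere (0 : Fin N → ℂ) 1 => p.2.1 :=
    continuous_subtype_val.comp continuous_snd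
  exact hv.star.dotProduct ((continuous_subtype_val.comp continuous_fst).matrix_mulVec hv)

theorem norm_dotProduct_mulVec_sq_le {m : Type*} [Fintype m] {G : Matrix m m ℂ}
    (hG : G.PosSemidef) (u v : m → ℂ) :
    ‖star u ⬝ᵥ (G *ᵥ v)‖ ^ 2 ≤ (star u ⬝ᵥ (G *ᵥ u)).re * (star v ⬝ᵥ (G *ᵥ v)).re := by
  classical
  obtain ⟨B, hB⟩ : ∃ B : Matrix m m ℂ, G = Bᴴ * B := by
    open scoped MatrixOrder in
    exact CStarAlgebra.nonneg_iff_eq_star_mul_self.1 hG.nonneg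
  have hform (u v : m → ℂ) : star u ⬝ᵥ (G *ᵥ v) =
      inner ℂ (WithLp.toLp 2 (B *ᵥ u) : EuclideanSpace ℂ m) (WithLp.toLp 2 (B *ᵥ v)) := by
    rw [hB, EuclideanSpace.inner_toLp_toLp, ← Matrix.mulVec_mulVec, Matrix.dotProduct_mulVec,
      Matrix.star_mulVec, dotProduct_comm]
  have hself (v : m → ℂ) : (star v ⬝ᵥ (G *ᵥ v)).re =
      ‖(WithLp.toLp 2 (B *ᵥ v) : EuclideanSpace ℂ m)‖ ^ 2 := by
    rw [hform]
    exact inner_self_eq_norm_sq (𝕜 := ℂ) _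
  rw [hself, hself, hform, ← mul_pow]
  gcongr
  exact norm_inner_le_norm _ _

theorem iSup_norm_dotProduct_sq_div {m : Type*} [Fintype m] [DecidableEq m] {G : Matrix m m ℂ}
    (hG : G.PosDef) {Z : m → ℂ} (hZ : Z ≠ 0) :
    ⨆ v : {v : m → ℂ // v ≠ 0}, ‖Z ⬝ᵥ v.1‖ ^ 2 / (star v.1 ⬝ᵥ (G⁻¹ *ᵥ v.1)).re =
      (Z ⬝ᵥ (G *ᵥ star Z)).re := by
  have hdet : IsUnit G.det := hG.det_pos.ne'.isUnit
  set y := G *ᵥ star Z with hy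
  have hGy : G⁻¹ *ᵥ y = star Z := by
    rw [hy, Matrix.mulVec_mulVec, Matrix.nonsing_inv_mul _ hdet, Matrix.one_mulVec]
  have hZ_dotProduct (v : m → ℂ) : Z ⬝ᵥ v = star y ⬝ᵥ (G⁻¹ *ᵥ v) := by
    rw [Matrix.dotProduct_mulVec, ← hG.inv.1.eq, ← Matrix.star_mulVec, hGy, star_star]
  have hy0 : y ≠ 0 := fun h => hZ (by rw [← star_eq_zero, ← hGy, h, Matrix.mulVec_zero])
  have hypos : 0 < (Z ⬝ᵥ y).re := hZ_dotProduct y ▸ re_dotProduct_mulVec_pos hG.inv hy0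
  have hle (v : {v : m → ℂ // v ≠ 0}) :
      ‖Z ⬝ᵥ v.1‖ ^ 2 / (star v.1 ⬝ᵥ (G⁻¹ *ᵥ v.1)).re ≤ (Z ⬝ᵥ y).re := by
    rw [div_le_iff₀ (re_dotProduct_mulVec_pos hG.inv v.2), hZ_dotProduct, hZ_dotProduct]
    exact norm_dotProduct_mulVec_sq_le hG.inv.posSemidef y v
  -- The supremum is attained at `v = G Z̄`, the equality case of Cauchy-Schwarz.
  have hattained : ‖Z ⬝ᵥ y‖ ^ 2 / (star y ⬝ᵥ (G⁻¹ *ᵥ y)).re = (Z ⬝ᵥ y).re := by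
    have him : (Z ⬝ᵥ y).im = 0 := by
      rw [hZ_dotProduct]
      exact hG.inv.1.im_star_dotProduct_mulVec_self y
    rw [← hZ_dotProduct, ← Complex.abs_re_eq_norm.2 him, sq_abs, sq,
      mul_div_cancel_right₀ _ hypos.ne']
  have : Nonempty {v : m → ℂ // v ≠ 0} := ⟨⟨y, hy0⟩⟩
  exact le_antisymm (ciSup_le hle)
    (hattained.ge.trans (le_ciSup (bddAbove_def.2 ⟨_, Set.forall_mem_range.2 hle⟩) ⟨y, hy0⟩))

variable {V : Type*} [AddCommGroup V] [Module ℂ V] (b : Module.Basis (Fin N) ℂ V)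

theorem posDef_gram {H : SesqForm V} (hH : IsHermForm H) : (gram b H).PosDef := by
  refine Matrix.PosDef.of_dotProduct_mulVec_pos (Matrix.ext fun i j => hH.1.eq _ _) fun v hv => ?_
  have happly : star v ⬝ᵥ (gram b H *ᵥ v) = H (∑ i, v i • b i) (∑ i, v i • b i) := by
    simp only [map_sum, LinearMap.sum_apply, LinearMap.map_smulₛₗ, LinearMap.smul_apply,
      dotProduct, Matrix.mulVec, gram, Matrix.of_apply, Finset.mul_sum, smul_eq_mul,
      RingHom.id_apply, Pi.star_apply, starRingEnd_apply]
    rw [Finset.sum_comm]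
    exact Finset.sum_congr rfl fun i _ => Finset.sum_congr rfl fun j _ => by ring
  have hne : ∑ i, v i • b i ≠ 0 := by
    rw [← b.equivFun_symm_apply]
    exact b.equivFun.symm.map_ne_zero_iff.2 hv
  rw [happly]
  exact Complex.pos_iff.2 ⟨hH.2 _ hne, (Complex.conj_eq_iff_im.1 (hH.1.eq _ _)).symm⟩

theorem gram_formOf (G : Matrix (Fin N) (Fin N) ℂ) : gram b (formOf b G) = G⁻¹ :=
  Matrix.ext (formOf_apply_basis b G)

theorem eq_formOf_of_orthonormal {H : SesqForm V}
    (hH : ∀ i j, H (b i) (b j) = if i = j then 1 else 0) : H = formOf b (idHerm N).1 := by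
  refine b.ext fun i => b.ext fun j => ?_
  rw [hH, formOf_apply_basis]
  simp [idHerm, Matrix.one_apply]

end PositiveDefinite

section Coefficients

variable {n : ℕ} {X : Type*} [TopologicalSpace X] [ChartedSpace (Model n) X]
  [IsManifold 𝓘(ℂ, Model n) ω X] {k N : ℕ}

/-- The determinant of the Jacobian matrix of the change of charts from `i` to `j`, which is the
transition function of `-K_X`. -/
def jacobianDet (i j : atlas (Model n) X) (x : X) : ℂ :=
  ((tangentBundleCore 𝓘(ℂ, Model n) X).coordChange i j x).det

theorem coeff_change {i j : atlas (Model n) X} (σ : H0 n X k) {x : X} (hi : x ∈ i.1.source)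
    (hj : x ∈ j.1.source) : coeff j σ x = jacobianDet i j x ^ k * coeff i σ x :=
  ((anticanonicalCore n X k).coordChange_comp (achart (Model n) x) i j x
    ⟨⟨mem_chart_source _ x, hi⟩, hj⟩ (σ x)).symm

theorem jacobianDet_mul {i j : atlas (Model n) X} {x : X} (hi : x ∈ i.1.source)
    (hj : x ∈ j.1.source) : jacobianDet j i x * jacobianDet i j x = 1 := by
  set T := tangentBundleCore 𝓘(ℂ, Model n) X
  have hcomp : (T.coordChange j i x).comp (T.coordChange i j x) = .id ℂ _ := by
    ext1 v
    exact (T.coordChange_comp i j i x ⟨⟨hi, hj⟩, hi⟩ v).trans (T.coordChange_self i x hi v)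
  exact (LinearMap.det_comp _ _).symm.trans
    ((congrArg (fun f : Model n →L[ℂ] Model n => f.det) hcomp).trans LinearMap.det_id)

theorem jacobianDet_ne_zero {i j : atlas (Model n) X} {x : X} (hi : x ∈ i.1.source)
    (hj : x ∈ j.1.source) : jacobianDet i j x ≠ 0 :=
  right_ne_zero_of_mul_eq_one (jacobianDet_mul hi hj)

theorem continuousOn_coeff (i : atlas (Model n) X) (σ : H0 n X k) :
    ContinuousOn (coeff i σ) i.1.source :=
  continuous_snd.comp_continuousOn <|
    ((anticanonicalCore n X k).localTriv i).continuousOn.comp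
      σ.contMDiff.continuous.continuousOn fun _ hx =>
        (VectorBundleCore.mem_localTriv_source _ _ _).2 hx

theorem isLinearMap_coeff (i : atlas (Model n) X) (x : X) :
    IsLinearMap ℂ fun σ : H0 n X k => coeff i σ x where
  map_add σ τ := map_add ((anticanonicalCore n X k).coordChange _ i x) (σ x) (τ x)
  map_smul c σ := map_smul ((anticanonicalCore n X k).coordChange _ i x) c (σ x)

/-- The values at `x` of the sections of a basis, in the frame of the chart `i`; for the preferred
chart at `x` these are the `homogeneousCoords`. -/
def coordVec (s : Module.Basis (Fin N) ℂ (H0 n X k)) (i : atlas (Model n) X) (x : X) : Vec N :=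
  WithLp.toLp 2 fun j => coeff i (s j) x

variable (s : Module.Basis (Fin N) ℂ (H0 n X k)) {i j : atlas (Model n) X} {x : X}

theorem coeff_eq_dotProduct (i : atlas (Model n) X) (x : X) (σ : H0 n X k) :
    coeff i σ x = (coordVec s i x).ofLp ⬝ᵥ s.equivFun σ := by
  have hsum := congrArg ((isLinearMap_coeff (k := k) i x).mk') (s.sum_equivFun σ)
  simp only [map_sum, map_smul, IsLinearMap.mk'_apply, smul_eq_mul] at hsum
  rw [← hsum, dotProduct_comm]
  rfl

theorem coordVec_change (hi : x ∈ i.1.source) (hj : x ∈ j.1.source) :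
    coordVec s j x = jacobianDet i j x ^ k • coordVec s i x := by
  ext l
  exact coeff_change (s l) hi hj

theorem continuousOn_coordVec (i : atlas (Model n) X) :
    ContinuousOn (coordVec s i) i.1.source :=
  (PiLp.continuous_toLp 2 _).comp_continuousOn
    (continuousOn_pi.2 fun j => continuousOn_coeff i (s j))

variable (h : ∀ x : X, ∃ σ : H0 n X k, σ x ≠ 0)

include h in
theorem coordVec_ne_zero (hi : x ∈ i.1.source) : coordVec s i x ≠ 0 := by
  rw [coordVec_change s (i := achart (Model n) x) (mem_chart_source _ x) hi]
  exact smul_ne_zero (pow_ne_zero _ (jacobianDet_ne_zero (mem_chart_source _ x) hi))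
    (homogeneousCoords_ne_zero s h x)

theorem momentMap_kodairaMap (hi : x ∈ i.1.source) :
    momentMap (kodairaMap s h x) = momentMatrix (coordVec s i x) := by
  rw [coordVec_change s (i := achart (Model n) x) (mem_chart_source _ x) hi,
    momentMatrix_smul _ (pow_ne_zero _ (jacobianDet_ne_zero (mem_chart_source _ x) hi))]
  rfl

theorem continuousAt_momentMatrix {Z : Vec N} (hZ : Z ≠ 0) : ContinuousAt momentMatrix Z := by
  refine continuousAt_pi.2 fun α => continuousAt_pi.2 fun β => ?_
  have hproj (j : Fin N) : Continuous fun Z : Vec N => Z j := (EuclideanSpace.proj j).continuous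
  simp only [momentMatrix, Matrix.of_apply, sum_norm_sq_eq]
  exact ((Complex.continuous_conj.comp (hproj α)).mul (hproj β)).continuousAt.div
    ((Complex.continuous_ofReal.comp continuous_norm).pow 2).continuousAt (by simpa using hZ)

theorem continuous_momentMap_kodairaMap : Continuous fun x => momentMap (kodairaMap s h x) := by
  refine continuous_iff_continuousAt.2 fun x => ?_
  set i := achart (Model n) x
  have hi : i.1.source ∈ 𝓝 x := i.1.open_source.mem_nhds (mem_chart_source _ x)
  refine ((continuousAt_momentMatrix (coordVec_ne_zero s h (mem_of_mem_nhds hi))).comp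
    ((continuousOn_coordVec s i).continuousAt hi)).congr ?_
  filter_upwards [hi] with y hy using (momentMap_kodairaMap s h hy).symm

theorem continuous_hamiltonian_kodairaMap (A : HermMat N) :
    Continuous fun x => hamiltonian A (kodairaMap s h x) :=
  Complex.continuous_re.comp
    (continuous_const.matrix_mul (continuous_momentMap_kodairaMap s h)).matrix_trace

theorem re_dotProduct_mulVec_star (G : Matrix (Fin N) (Fin N) ℂ) {Z : Vec N} (hZ : Z ≠ 0) :
    (Z.ofLp ⬝ᵥ (G *ᵥ star Z.ofLp)).re = ‖Z‖ ^ 2 * (G * momentMatrix Z).trace.re := by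
  have hZ' : ‖Z‖ ^ 2 ≠ 0 := by simpa using hZ
  rw [trace_mul_momentMatrix, ← Complex.ofReal_pow, Complex.div_ofReal_re,
    mul_div_cancel₀ _ hZ', Matrix.dotProduct_mulVec, ← Matrix.mulVec_transpose]
  rfl

open scoped ComplexOrder in
theorem hamiltonian_pos {G : HermMat N} (hG : G.1.PosDef) (p : CP N) : 0 < hamiltonian G p := by
  obtain ⟨Z, h0⟩ := exists_mem_submodule_ne_zero p
  have hZ : (Z : Vec N) ≠ 0 := by simpa using h0
  have hpos := re_dotProduct_mulVec_pos hG (v := star (Z : Vec N).ofLp)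
    (star_ne_zero.2 ((WithLp.ofLp_eq_zero 2).not.2 hZ))
  rw [star_star, re_dotProduct_mulVec_star _ hZ] at hpos
  rw [← mk_eq_of_mem Z.2 hZ]
  exact pos_of_mul_pos_right hpos (by positivity)

theorem hamiltonian_idHerm (p : CP N) : hamiltonian (idHerm N) p = 1 := by
  obtain ⟨Z, h0⟩ := exists_mem_submodule_ne_zero p
  have hid : linearField (idHerm N).1 = .id ℂ (Vec N) := by
    ext1 v
    simp [linearField, idHerm]
  have hZ : ‖(Z : Vec N)‖ ^ 2 ≠ 0 := by simpa using h0
  rw [hamiltonian_eq_rayleighQuotient _ Z.2 (by simpa using h0), hid,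
    ContinuousLinearMap.rayleighQuotient, ContinuousLinearMap.reApplyInnerSelf_apply,
    ContinuousLinearMap.id_apply, inner_self_eq_norm_sq, div_self hZ]

end Coefficients

section Measures

variable {X : Type*} [MeasurableSpace X]

theorem withDensity_mono_measure {μ ν : Measure X} (h : μ ≤ ν) (f : X → ℝ≥0∞) :
    μ.withDensity f ≤ ν.withDensity f :=
  Measure.le_iff.2 fun s hs => by
    rw [withDensity_apply f hs, withDensity_apply f hs]
    exact lintegral_mono' (Measure.restrict_mono le_rfl h) le_rfl

theorem withDensity_iSup {ι : Type*} (ν : ι → Measure X) {f : X → ℝ≥0∞} (hf : Measurable f)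
    (h0 : ∀ x, f x ≠ 0) (hT : ∀ x, f x ≠ ⊤) :
    (⨆ i, ν i).withDensity f = ⨆ i, (ν i).withDensity f := by
  have hinv (μ : Measure X) : (μ.withDensity f).withDensity f⁻¹ = μ :=
    withDensity_inv_same hf (.of_forall h0) (.of_forall hT)
  have hinv' (μ : Measure X) : (μ.withDensity f⁻¹).withDensity f = μ := by
    simpa only [Pi.inv_apply, inv_inv] using withDensity_inv_same (μ := μ) hf.inv
      (.of_forall fun x => ENNReal.inv_ne_zero.2 (hT x))
      (.of_forall fun x => ENNReal.inv_ne_top.2 (h0 x))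
  refine le_antisymm ?_ (iSup_le fun i => withDensity_mono_measure (le_iSup ν i) f)
  have hle : ⨆ i, ν i ≤ (⨆ i, (ν i).withDensity f).withDensity f⁻¹ := iSup_le fun i =>
    (hinv (ν i)).ge.trans
      (withDensity_mono_measure (le_iSup (fun i => (ν i).withDensity f) i) _)
  exact (withDensity_mono_measure hle f).trans (hinv' _).le

theorem withDensity_map {Y : Type*} [MeasurableSpace Y] {μ : Measure Y} {T : Y → X}
    (hT : AEMeasurable T μ) {f : X → ℝ≥0∞} (hf : Measurable f) [SFinite μ] :
    (μ.map T).withDensity f = (μ.withDensity (f ∘ T)).map T := by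
  ext s hs
  rw [withDensity_apply _ hs, Measure.restrict_map_of_aemeasurable hT hs,
    lintegral_map' hf.aemeasurable (hT.mono_measure Measure.restrict_le_self),
    Measure.map_apply_of_aemeasurable (hT.mono_ac (withDensity_absolutelyContinuous _ _)) hs,
    withDensity_apply']
  rfl

end Measures

section CanonicalVolume

theorem abs_det_restrictScalars {n : ℕ} (f : Model n →L[ℂ] Model n) :
    |(f.restrictScalars ℝ).det| = ‖f.det‖ ^ 2 := by
  have hdet : (f.restrictScalars ℝ).det = Algebra.norm ℝ f.det :=
    LinearMap.det_restrictScalars (f := (f : Model n →ₗ[ℂ] Model n))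
  rw [hdet, Algebra.norm_complex_apply, Complex.normSq_eq_norm_sq, abs_of_nonneg (by positivity)]

variable {n : ℕ} {X : Type*} [TopologicalSpace X] [ChartedSpace (Model n) X]

theorem hasFDerivAt_coordChange [IsManifold 𝓘(ℂ, Model n) ω X] {i j : atlas (Model n) X} {x : X}
    (hi : x ∈ i.1.source) (hj : x ∈ j.1.source) :
    HasFDerivAt (j.1 ∘ i.1.symm)
      ((tangentBundleCore 𝓘(ℂ, Model n) X).coordChange i j x) (i.1 x) := by
  have hdiff : DifferentiableWithinAt ℂ
      (j.1.extend 𝓘(ℂ, Model n) ∘ (i.1.extend 𝓘(ℂ, Model n)).symm)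
      (Set.range 𝓘(ℂ, Model n)) (i.1.extend 𝓘(ℂ, Model n) x) :=
    (ModelWithCorners.contDiffWithinAt_extendCoordChange' (n := ω) (I := 𝓘(ℂ, Model n))
        (IsManifold.subset_maximalAtlas i.2) (IsManifold.subset_maximalAtlas j.2)
        hi hj).differentiableWithinAt (by simp)
  have hderiv := hdiff.hasFDerivWithinAt
  simp only [modelWithCornersSelf_coe, Set.range_id, hasFDerivWithinAt_univ] at hderiv
  have hcoordChange : (tangentBundleCore 𝓘(ℂ, Model n) X).coordChange i j x =
      fderivWithin ℂ (j.1.extend 𝓘(ℂ, Model n) ∘ (i.1.extend 𝓘(ℂ, Model n)).symm)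
        (Set.range 𝓘(ℂ, Model n)) (i.1.extend 𝓘(ℂ, Model n) x) := rfl
  rw [hcoordChange]
  simpa using hderiv

/-- Local weights which are continuous and transform like those of a hermitian metric on `-K_X`.
The value of a weight outside its chart is arbitrary. -/
structure IsContinuousMetric [IsManifold 𝓘(ℂ, Model n) ω X] (φ : atlas (Model n) X → X → ℝ) :
    Prop where
  continuousOn (i : atlas (Model n) X) : ContinuousOn (φ i) i.1.source
  change {i j : atlas (Model n) X} {x : X} (hi : x ∈ i.1.source) (hj : x ∈ j.1.source) :
    φ j x = φ i x + Real.log (‖jacobianDet i j x‖ ^ 2)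

theorem IsContinuousMetric.norm_sq_jacobianDet_mul_exp_neg [IsManifold 𝓘(ℂ, Model n) ω X]
    {φ : atlas (Model n) X → X → ℝ} (hφ : IsContinuousMetric φ) {i j : atlas (Model n) X} {x : X}
    (hi : x ∈ i.1.source) (hj : x ∈ j.1.source) :
    ‖jacobianDet i j x‖ ^ 2 * Real.exp (-φ j x) = Real.exp (-φ i x) := by
  have hJ : 0 < ‖jacobianDet i j x‖ ^ 2 :=
    pow_pos (norm_pos_iff.2 (jacobianDet_ne_zero hi hj)) 2
  rw [hφ.change hi hj, neg_add, Real.exp_add, Real.exp_neg (Real.log _), Real.exp_log hJ,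
    mul_left_comm, mul_inv_cancel₀ hJ.ne', mul_one]

theorem IsContinuousMetric.continuousOn_density [IsManifold 𝓘(ℂ, Model n) ω X]
    {φ : atlas (Model n) X → X → ℝ} (hφ : IsContinuousMetric φ) (i : atlas (Model n) X) :
    ContinuousOn (fun z => 2 ^ n * Real.exp (-φ i (i.1.symm z))) i.1.target :=
  continuousOn_const.mul ((hφ.continuousOn i).comp i.1.continuousOn_symm i.1.mapsTo_symm).neg.rexp

variable [MeasurableSpace X]

/-- The measure on `X` given by the volume form `e^{-φ}` in a single chart. -/
def chartVolume (φ : atlas (Model n) X → X → ℝ) (i : atlas (Model n) X) : Measure X :=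
  (((volume : Measure (Model n)).restrict i.1.target).withDensity
    fun z => ENNReal.ofReal (2 ^ n * Real.exp (-φ i (i.1.symm z)))).map i.1.symm

theorem canonicalVolume_eq_iSup (φ : atlas (Model n) X → X → ℝ) :
    canonicalVolume φ = ⨆ i, chartVolume φ i := rfl

variable [BorelSpace X]

theorem aemeasurable_chart_symm (i : atlas (Model n) X) :
    AEMeasurable i.1.symm ((volume : Measure (Model n)).restrict i.1.target) :=
  i.1.continuousOn_symm.aemeasurable i.1.open_target.measurableSet

theorem measurableSet_target_inter_preimage (i : atlas (Model n) X) {E : Set X}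
    (hE : MeasurableSet E) : MeasurableSet (i.1.target ∩ i.1.symm ⁻¹' E) := by
  have hpre := i.1.open_target.measurableSet.subtype_image
    ((continuousOn_iff_continuous_domRestrict.1 i.1.continuousOn_symm).measurable hE)
  rwa [Set.domRestrict_eq, Set.preimage_comp, Subtype.image_preimage_coe] at hpre

theorem chartVolume_apply (φ : atlas (Model n) X → X → ℝ) (i : atlas (Model n) X) {E : Set X}
    (hE : MeasurableSet E) :
    chartVolume φ i E = ∫⁻ z in i.1.target ∩ i.1.symm ⁻¹' E,
      ENNReal.ofReal (2 ^ n * Real.exp (-φ i (i.1.symm z))) := by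
  have hi := aemeasurable_chart_symm i
  rw [chartVolume, Measure.map_apply_of_aemeasurable
    (hi.mono_ac (withDensity_absolutelyContinuous _ _)) hE, withDensity_apply',
    Measure.restrict_restrict₀ (hi.nullMeasurableSet_preimage hE), Set.inter_comm]

theorem chartVolume_compl_source (φ : atlas (Model n) X → X → ℝ) (i : atlas (Model n) X) :
    chartVolume φ i i.1.sourceᶜ = 0 := by
  have hempty : i.1.target ∩ i.1.symm ⁻¹' i.1.sourceᶜ = ∅ :=
    Set.eq_empty_of_forall_notMem fun z hz => hz.2 (i.1.map_target hz.1)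
  rw [chartVolume_apply _ _ i.1.open_source.measurableSet.compl, hempty, Measure.restrict_empty,
    lintegral_zero_measure]

theorem chartVolume_inter_source (φ : atlas (Model n) X → X → ℝ) (i : atlas (Model n) X)
    (E : Set X) : chartVolume φ i (E ∩ i.1.source) = chartVolume φ i E :=
  measure_inter_conull (chartVolume_compl_source φ i)

variable [IsManifold 𝓘(ℂ, Model n) ω X] {φ : atlas (Model n) X → X → ℝ}

theorem IsContinuousMetric.chartVolume_eq_of_subset (hφ : IsContinuousMetric φ)
    {i j : atlas (Model n) X} {E : Set X} (hE : MeasurableSet E) (hi : E ⊆ i.1.source)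
    (hj : E ⊆ j.1.source) : chartVolume φ i E = chartVolume φ j E := by
  set S := i.1.target ∩ i.1.symm ⁻¹' E
  have hS_eq : S = i.1 '' E := (i.1.image_eq_target_inter_inv_preimage hi).symm
  have hS_meas : MeasurableSet S := measurableSet_target_inter_preimage i hE
  have himage : j.1.target ∩ j.1.symm ⁻¹' E = (j.1 ∘ i.1.symm) '' S := by
    rw [← j.1.image_eq_target_inter_inv_preimage hj, hS_eq, Set.image_image]
    exact Set.image_congr fun x hx => by rw [Function.comp_apply, i.1.left_inv (hi hx)]
  have hinj : Set.InjOn (j.1 ∘ i.1.symm) S :=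
    j.1.injOn.comp (i.1.symm.injOn.mono Set.inter_subset_left) fun z hz => hj hz.2
  have hderiv (z) (hz : z ∈ S) : HasFDerivWithinAt (j.1 ∘ i.1.symm)
      (((tangentBundleCore 𝓘(ℂ, Model n) X).coordChange i j (i.1.symm z)).restrictScalars ℝ)
      S z := by
    have h := hasFDerivAt_coordChange (hi hz.2) (hj hz.2)
    rw [i.1.right_inv hz.1] at h
    exact (h.restrictScalars ℝ).hasFDerivWithinAt
  rw [chartVolume_apply φ i hE, chartVolume_apply φ j hE, himage,
    lintegral_image_eq_lintegral_abs_det_fderiv_mul volume hS_meas hderiv hinj]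
  refine setLIntegral_congr_fun hS_meas fun z hz => ?_
  rw [abs_det_restrictScalars, Function.comp_apply, j.1.left_inv (hj hz.2),
    ← ENNReal.ofReal_mul (by positivity), mul_left_comm, ← jacobianDet,
    hφ.norm_sq_jacobianDet_mul_exp_neg (hi hz.2) (hj hz.2)]

theorem IsContinuousMetric.restrict_canonicalVolume_le (hφ : IsContinuousMetric φ)
    (i : atlas (Model n) X) : (canonicalVolume φ).restrict i.1.source ≤ chartVolume φ i := by
  have hi := i.1.open_source.measurableSet
  have hle : canonicalVolume φ ≤
      chartVolume φ i + (canonicalVolume φ).restrict i.1.sourceᶜ := by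
    refine iSup_le fun j => Measure.le_iff.2 fun E hE => ?_
    change chartVolume φ j E ≤ _
    rw [← measure_inter_add_sdiff E hi, Measure.add_apply, Measure.restrict_apply hE]
    refine add_le_add ?_ (le_iSup (chartVolume φ) j _)
    rw [← chartVolume_inter_source φ j, ← hφ.chartVolume_eq_of_subset
      ((hE.inter hi).inter j.1.open_source.measurableSet)
      (Set.inter_subset_left.trans Set.inter_subset_right) Set.inter_subset_right]
    exact measure_mono (Set.inter_subset_left.trans Set.inter_subset_left)
  refine Measure.le_iff.2 fun E hE => ?_
  rw [Measure.restrict_apply hE]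
  refine (hle _).trans ?_
  rw [Measure.add_apply, Measure.restrict_apply (hE.inter hi), Set.inter_assoc,
    Set.inter_compl_self, Set.inter_empty, measure_empty, add_zero]
  exact measure_mono Set.inter_subset_left

theorem IsContinuousMetric.isLocallyFiniteMeasure_canonicalVolume (hφ : IsContinuousMetric φ) :
    IsLocallyFiniteMeasure (canonicalVolume φ) := by
  refine ⟨fun x => ?_⟩
  set i := achart (Model n) x
  have hi : x ∈ i.1.source := mem_chart_source _ x
  obtain ⟨K, hK, hxK, hKi⟩ := exists_compact_subset i.1.open_target (i.1.map_source hi)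
  set U := i.1.source ∩ i.1 ⁻¹' interior K
  have hU_open : IsOpen U := i.1.isOpen_inter_preimage isOpen_interior
  refine ⟨U, hU_open.mem_nhds ⟨hi, hxK⟩, ?_⟩
  have hsub : i.1.target ∩ i.1.symm ⁻¹' U ⊆ K := fun z hz => by
    simpa only [i.1.right_inv hz.1] using interior_subset hz.2.2
  calc canonicalVolume φ U = (canonicalVolume φ).restrict i.1.source U :=
        (Measure.restrict_eq_self _ Set.inter_subset_left).symm
    _ ≤ chartVolume φ i U := hφ.restrict_canonicalVolume_le i U
    _ ≤ ∫⁻ z in K, ENNReal.ofReal (2 ^ n * Real.exp (-φ i (i.1.symm z))) := by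
      rw [chartVolume_apply φ i hU_open.measurableSet]
      exact lintegral_mono_set hsub
    _ < ⊤ := (((hφ.continuousOn_density i).mono hKi).integrableOn_compact hK).lintegral_lt_top

theorem IsContinuousMetric.neZero_canonicalVolume [Nonempty X] (hφ : IsContinuousMetric φ) :
    NeZero (canonicalVolume φ) := by
  obtain ⟨x⟩ := ‹Nonempty X›
  set i := achart (Model n) x
  suffices h : chartVolume φ i Set.univ ≠ 0 from
    ⟨fun h0 => h (le_zero_iff.1 ((le_iSup (chartVolume φ) i Set.univ).trans_eq
      (Measure.measure_univ_eq_zero.2 h0)))⟩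
  rw [chartVolume_apply φ i .univ, Set.preimage_univ, Set.inter_univ]
  have hvol : volume i.1.target ≠ 0 :=
    (i.1.open_target.measure_pos volume ⟨_, i.1.map_source (mem_chart_source _ x)⟩).ne'
  have hdensity := ((hφ.continuousOn_density i).aemeasurable
    i.1.open_target.measurableSet).ennreal_ofReal (μ := volume.restrict i.1.target)
  intro h0
  have hpos (z : Model n) : ENNReal.ofReal (2 ^ n * Real.exp (-φ i (i.1.symm z))) ≠ 0 :=
    (ENNReal.ofReal_pos.2 (by positivity)).ne'
  have hfalse : ∀ᵐ _ ∂(volume : Measure (Model n)).restrict i.1.target, False :=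
    ((lintegral_eq_zero_iff' hdensity).1 h0).mono fun z hz => hpos z hz
  exact hvol (Measure.restrict_eq_zero.1 (ae_eq_bot.1 (eventually_false_iff_eq_bot.1 hfalse)))

theorem IsContinuousMetric.canonicalVolume_eq_withDensity (hφ : IsContinuousMetric φ)
    {ψ : atlas (Model n) X → X → ℝ} {u : X → ℝ} (hu : Measurable u)
    (h : ∀ i : atlas (Model n) X, ∀ x ∈ i.1.source, ψ i x = φ i x + u x) :
    canonicalVolume ψ =
      (canonicalVolume φ).withDensity fun x => ENNReal.ofReal (Real.exp (-u x)) := by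
  have hf : Measurable fun x => ENNReal.ofReal (Real.exp (-u x)) := by fun_prop
  rw [canonicalVolume_eq_iSup, canonicalVolume_eq_iSup, withDensity_iSup _ hf
    (fun x => (ENNReal.ofReal_pos.2 (Real.exp_pos _)).ne') (fun x => ENNReal.ofReal_ne_top)]
  refine iSup_congr fun i => ?_
  have hi := i.1.open_target.measurableSet
  have hT := aemeasurable_chart_symm i
  rw [chartVolume, chartVolume,
    withDensity_map (hT.mono_ac (withDensity_absolutelyContinuous _ _)) hf,
    ← withDensity_mul₀ ((hφ.continuousOn_density i).aemeasurable hi).ennreal_ofReal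
      (hf.comp_aemeasurable hT)]
  congr 1
  refine withDensity_congr_ae ?_
  filter_upwards [ae_restrict_mem hi] with z hz
  rw [h i _ (i.1.map_target hz), neg_add, Real.exp_add, ← mul_assoc,
    ENNReal.ofReal_mul (by positivity)]
  rfl

end CanonicalVolume

section FubiniStudy

open scoped ComplexOrder

/-- The linear form `G ↦ H(G)(p)` on hermitian matrices given by the hamiltonians at a point `p`. -/
def hamiltonianCLM {N : ℕ} (p : CP N) : HermMat N →L[ℝ] ℝ :=
  LinearMap.toContinuousLinearMap <| IsLinearMap.mk' (fun G => hamiltonian G p)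
    { map_add := fun G G' => by
        simp [hamiltonian, Matrix.add_mul]
      map_smul := fun c G => by
        simp [hamiltonian] }

variable {n N k : ℕ} {X : Type*} [TopologicalSpace X] [ChartedSpace (Model n) X]
  [IsManifold 𝓘(ℂ, Model n) ω X] (s : Module.Basis (Fin N) ℂ (H0 n X k))
  (h : ∀ x : X, ∃ σ : H0 n X k, σ x ≠ 0) {G : HermMat N} {i : atlas (Model n) X} {x : X}

theorem continuous_hamiltonianCLM_kodairaMap :
    Continuous fun x => hamiltonianCLM (kodairaMap s h x) :=
  continuous_clm_apply.2 (continuous_hamiltonian_kodairaMap s h)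

theorem iSup_norm_coeff_sq_div (hG : G.1.PosDef) (hx : x ∈ i.1.source) :
    ⨆ σ : {σ : H0 n X k // σ ≠ 0}, ‖coeff i σ.1 x‖ ^ 2 / (formOf s G.1 σ.1 σ.1).re =
      ‖coordVec s i x‖ ^ 2 * hamiltonian G (kodairaMap s h x) := by
  have hZ := coordVec_ne_zero s h hx
  rw [hamiltonian, momentMap_kodairaMap s h hx, ← re_dotProduct_mulVec_star _ hZ,
    ← iSup_norm_dotProduct_sq_div hG ((WithLp.ofLp_eq_zero 2).not.2 hZ)]
  refine (s.equivFun.toEquiv.subtypeEquiv fun σ => s.equivFun.map_eq_zero_iff.symm.not).iSup_congr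
    fun σ => ?_
  rw [coeff_eq_dotProduct s]
  rfl

theorem fubiniStudyWeight_formOf (hk : 0 < k) (hG : G.1.PosDef) (hx : x ∈ i.1.source) :
    fubiniStudyWeight (formOf s G.1) i x =
      1 / (k : ℝ) * (Real.log ((k : ℝ) ^ n)⁻¹ + Real.log (‖coordVec s i x‖ ^ 2) +
        Real.log (hamiltonian G (kodairaMap s h x))) := by
  have hZ : ‖coordVec s i x‖ ^ 2 ≠ 0 := by simpa using coordVec_ne_zero s h hx
  have hH := (hamiltonian_pos hG (kodairaMap s h x)).ne'
  have hk' : ((k : ℝ) ^ n)⁻¹ ≠ 0 := by positivity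
  rw [fubiniStudyWeight, iSup_norm_coeff_sq_div s h hG hx, Real.log_mul hk' (mul_ne_zero hZ hH),
    Real.log_mul hZ hH, add_assoc]

include h in
theorem isContinuousMetric_fubiniStudyWeight (hk : 0 < k) (hG : G.1.PosDef) :
    IsContinuousMetric (fubiniStudyWeight (formOf s G.1) : atlas (Model n) X → X → ℝ) where
  continuousOn i := by
    have hH := (continuous_hamiltonian_kodairaMap s h G).log fun x => (hamiltonian_pos hG _).ne'
    have hZ : ContinuousOn (fun x => Real.log (‖coordVec s i x‖ ^ 2)) i.1.source :=
      ((continuousOn_coordVec s i).norm.pow 2).log fun x hx => by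
        simpa using coordVec_ne_zero s h hx
    exact (continuousOn_const.mul ((continuousOn_const.add hZ).add hH.continuousOn)).congr
      fun x hx => fubiniStudyWeight_formOf s h hk hG hx
  change {i j x} hi hj := by
    have hJ : ‖jacobianDet i j x‖ ^ 2 ≠ 0 := by simpa using jacobianDet_ne_zero hi hj
    have hZ : ‖coordVec s i x‖ ^ 2 ≠ 0 := by simpa using coordVec_ne_zero s h hi
    rw [fubiniStudyWeight_formOf s h hk hG hi, fubiniStudyWeight_formOf s h hk hG hj,
      coordVec_change s hi hj, norm_smul, norm_pow, mul_pow, pow_right_comm,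
      Real.log_mul (pow_ne_zero k hJ) hZ, Real.log_pow]
    field_simp
    ring

theorem fubiniStudyWeight_formOf_eq_add (hk : 0 < k) (hG : G.1.PosDef) (hx : x ∈ i.1.source) :
    fubiniStudyWeight (formOf s G.1) i x = fubiniStudyWeight (formOf s (idHerm N).1) i x +
      1 / (k : ℝ) * Real.log (hamiltonian G (kodairaMap s h x)) := by
  rw [fubiniStudyWeight_formOf s h hk hG hx, fubiniStudyWeight_formOf s h hk .one hx,
    hamiltonian_idHerm, Real.log_one, add_zero, mul_add]

variable [MeasurableSpace X] [BorelSpace X]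

theorem logVolume_fubiniStudyWeight (hk : 0 < k) (hG : G.1.PosDef) :
    logVolume (fubiniStudyWeight (formOf s G.1) : atlas (Model n) X → X → ℝ) =
      -Real.log (powerIntegral (canonicalVolume (fubiniStudyWeight (formOf s (idHerm N).1)))
        (fun x => hamiltonianCLM (kodairaMap s h x)) (-(1 / (k : ℝ))) (1 : X → ℝ) G) := by
  have hpos (x : X) : 0 < hamiltonian G (kodairaMap s h x) := hamiltonian_pos hG _
  have hu : Continuous fun x => 1 / (k : ℝ) * Real.log (hamiltonian G (kodairaMap s h x)) :=
    continuous_const.mul ((continuous_hamiltonian_kodairaMap s h G).log fun x => (hpos x).ne')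
  have hpow (x : X) : (hamiltonianCLM (kodairaMap s h x) G) ^ (-(1 / (k : ℝ))) • (1 : X → ℝ) x =
      Real.exp (-(1 / (k : ℝ) * Real.log (hamiltonian G (kodairaMap s h x)))) := by
    rw [Pi.one_apply, smul_eq_mul, mul_one, ← neg_mul, mul_comm]
    exact Real.rpow_def_of_pos (hpos x) _
  have hlintegral := integral_eq_lintegral_of_nonneg_ae
    (μ := canonicalVolume (fubiniStudyWeight (formOf s (idHerm N).1)))
    (.of_forall fun x => (Real.exp_pos (-(1 / (k : ℝ) *
      Real.log (hamiltonian G (kodairaMap s h x))))).le) hu.neg.rexp.aestronglyMeasurable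
  rw [logVolume, (isContinuousMetric_fubiniStudyWeight s h hk .one).canonicalVolume_eq_withDensity
      hu.measurable fun i x hx => fubiniStudyWeight_formOf_eq_add s h hk hG hx,
    withDensity_apply _ .univ, Measure.restrict_univ, ← hlintegral]
  exact congrArg (-Real.log ·) (integral_congr_ae (.of_forall fun x => (hpow x).symm))

end FubiniStudy

section Ding

open scoped ComplexOrder

variable {n N k : ℕ} {X : Type*} [TopologicalSpace X] [ChartedSpace (Model n) X]
  [IsManifold 𝓘(ℂ, Model n) ω X] (s : Module.Basis (Fin N) ℂ (H0 n X k))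
  {Href : SesqForm (H0 n X k)} (hHref : IsHermForm Href) {G : HermMat N}

include hHref in
theorem neg_quantizedEnergy_formOf (hG : G.1.PosDef) :
    -quantizedEnergy s Href (formOf s G.1) = -(1 / ((k : ℝ) * N)) * Real.log G.1.det.re +
      1 / ((k : ℝ) * N) * Real.log ((gram s Href)⁻¹).det.re := by
  have hdet : G.1.det.re ≠ 0 := re_det_ne_zero hG.1 hG.det_pos.ne'
  have href := (posDef_gram s hHref).inv
  have href' : ((gram s Href)⁻¹).det.re ≠ 0 := re_det_ne_zero href.1 href.det_pos.ne'
  rw [quantizedEnergy, gram_formOf, Matrix.det_mul, Matrix.det_nonsing_inv,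
    Ring.inverse_eq_inv', ← ofReal_re_det hG.1, ← Complex.ofReal_inv, Complex.re_ofReal_mul,
    Complex.ofReal_re,
    Real.log_mul (inv_ne_zero hdet) href', Real.log_inv]
  ring

variable [MeasurableSpace X] [BorelSpace X] (h : ∀ x : X, ∃ σ : H0 n X k, σ x ≠ 0)

include hHref in
theorem dingOnCone_eventuallyEq (hk : 0 < k) :
    dingOnCone s Href =ᶠ[𝓝 (idHerm N)] fun G : HermMat N =>
      (-(1 / ((k : ℝ) * N)) * Real.log G.1.det.re +
        1 / ((k : ℝ) * N) * Real.log ((gram s Href)⁻¹).det.re) +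
      -Real.log (powerIntegral (canonicalVolume (fubiniStudyWeight (formOf s (idHerm N).1)))
        (fun x => hamiltonianCLM (kodairaMap s h x)) (-(1 / (k : ℝ))) (1 : X → ℝ) G) := by
  have hone : idHerm N ∈ {G : HermMat N | G.1.PosDef} := Matrix.PosDef.one
  filter_upwards [isOpen_setOf_posDef.mem_nhds hone] with G hG
  rw [dingOnCone, quantizedDing, neg_quantizedEnergy_formOf s hHref hG,
    logVolume_fubiniStudyWeight s h hk hG]

variable [CompactSpace X]

include h in
theorem isFiniteMeasure_canonicalVolume_fubiniStudyWeight (hk : 0 < k) (hG : G.1.PosDef) :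
    IsFiniteMeasure (canonicalVolume (fubiniStudyWeight (formOf s G.1)) : Measure X) :=
  have := (isContinuousMetric_fubiniStudyWeight s h hk hG).isLocallyFiniteMeasure_canonicalVolume
  inferInstance

variable {μ : Measure X}
  (hμ : μ = canonicalProbability (fubiniStudyWeight (formOf s (idHerm N).1)))

include hμ in
theorem integral_re_fsInner_xi (hk : 0 < k) (A B : HermMat N) :
    ∫ x, (fsInner (kodairaMap s h x) (xi A (kodairaMap s h x)) (xi B (kodairaMap s h x))).re ∂μ =
      -(∫ x, hamiltonian (christoffel (idHerm N) A B) (kodairaMap s h x) ∂μ) -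
        ∫ x, hamiltonian A (kodairaMap s h x) * hamiltonian B (kodairaMap s h x) ∂μ := by
  subst hμ
  have := isFiniteMeasure_canonicalVolume_fubiniStudyWeight s h hk (G := idHerm N) .one
  have hH := continuous_hamiltonian_kodairaMap s h
  have hint {f : X → ℝ} (hf : Continuous f) : Integrable f
      (canonicalProbability (fubiniStudyWeight (formOf s (idHerm N).1))) :=
    (integrable_of_continuous hf).to_average
  simp only [re_fsInner_xi]
  exact (integral_sub (hint (hH _).neg) (hint ((hH A).mul (hH B)))).trans
    (congrArg (· - _) (integral_neg _))

variable [Nonempty X]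

include hHref h in
theorem contDiffAt_dingOnCone (hk : 0 < k) : ContDiffAt ℝ 2 (dingOnCone s Href) (idHerm N) := by
  have := isFiniteMeasure_canonicalVolume_fubiniStudyWeight s h hk (G := idHerm N) .one
  have := (isContinuousMetric_fubiniStudyWeight s h hk
    (G := idHerm N) .one).neZero_canonicalVolume
  have hdet : (idHerm N).1.det ≠ 0 := Matrix.PosDef.one.det_pos.ne'
  have henergy : ContDiffAt ℝ 2 (fun G : HermMat N => Real.log G.1.det.re) (idHerm N) :=
    (contDiffAt_log_det_hermMat hdet).of_le le_top
  have hvolume := contDiffAt_neg_log_powerIntegral (E := HermMat N)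
    (ν := canonicalVolume (fubiniStudyWeight (formOf s (idHerm N).1)))
    (continuous_hamiltonianCLM_kodairaMap s h) (-(1 / (k : ℝ))) 2 (G := idHerm N)
    fun x => hamiltonian_idHerm _
  exact (((contDiffAt_const.mul henergy).add contDiffAt_const).add hvolume).congr_of_eventuallyEq
    (dingOnCone_eventuallyEq s hHref h hk)

include hHref hμ in
theorem riemannianHessian_dingOnCone_eq_christoffel (hk : 0 < k) (A B : HermMat N) :
    riemannianHessian (dingOnCone s Href) (idHerm N) A B =
      -(1 / (k : ℝ)) * (∫ x, hamiltonian (christoffel (idHerm N) A B) (kodairaMap s h x) ∂μ) -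
        -(1 / (k : ℝ)) * (-(1 / (k : ℝ)) - 1) *
          (∫ x, hamiltonian A (kodairaMap s h x) * hamiltonian B (kodairaMap s h x) ∂μ) +
        (-(1 / (k : ℝ))) ^ 2 * (∫ x, hamiltonian A (kodairaMap s h x) ∂μ) *
          ∫ x, hamiltonian B (kodairaMap s h x) ∂μ := by
  subst hμ
  have := isFiniteMeasure_canonicalVolume_fubiniStudyWeight s h hk (G := idHerm N) .one
  have := (isContinuousMetric_fubiniStudyWeight s h hk
    (G := idHerm N) .one).neZero_canonicalVolume
  have hdet : (idHerm N).1.det ≠ 0 := Matrix.PosDef.one.det_pos.ne'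
  have hL := continuous_hamiltonianCLM_kodairaMap s h
  have hone (x : X) : hamiltonianCLM (kodairaMap s h x) (idHerm N) = 1 := hamiltonian_idHerm _
  set a := -(1 / ((k : ℝ) * N))
  set b := 1 / ((k : ℝ) * N) * Real.log ((gram s Href)⁻¹).det.re
  set r := -(1 / (k : ℝ))
  set ν : Measure X := canonicalVolume (fubiniStudyWeight (formOf s (idHerm N).1))
  set Γ := christoffel (idHerm N) A B
  have henergy : ContDiffAt ℝ 2 (fun G : HermMat N => a * Real.log G.1.det.re + b) (idHerm N) :=
    (contDiffAt_const.mul ((contDiffAt_log_det_hermMat hdet).of_le le_top)).add contDiffAt_const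
  calc riemannianHessian (dingOnCone s Href) (idHerm N) A B
      = covariantHessian (dingOnCone s Href) (idHerm N) Γ A B := rfl
    _ = _ := covariantHessian_congr (dingOnCone_eventuallyEq s hHref h hk) Γ A B
    _ = _ := covariantHessian_add henergy
      (contDiffAt_neg_log_powerIntegral (E := HermMat N) hL r 2 hone) Γ A B
    _ = a * 0 + _ := congrArg₂ (· + ·)
      ((covariantHessian_const_mul_add _ a b _ Γ A B).trans
        (congrArg (a * ·) (covariantHessian_log_det hdet A B)))
      (covariantHessian_neg_log_powerIntegral (E := HermMat N) hL r hone Γ A B)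
    _ = _ := by
      rw [mul_zero, zero_add]
      rfl

include hHref hμ in
theorem riemannianHessian_dingOnCone (hk : 0 < k) (A B : HermMat N) :
    riemannianHessian (dingOnCone s Href) (idHerm N) A B =
      (k : ℝ)⁻¹ * (∫ x, (fsInner (kodairaMap s h x) (xi A (kodairaMap s h x))
        (xi B (kodairaMap s h x))).re ∂μ) -
      ((k : ℝ) ^ 2)⁻¹ *
        (∫ x, hamiltonian A (kodairaMap s h x) * hamiltonian B (kodairaMap s h x) ∂μ) +
      ((k : ℝ) ^ 2)⁻¹ * ((∫ x, hamiltonian A (kodairaMap s h x) ∂μ) *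
        ∫ x, hamiltonian B (kodairaMap s h x) ∂μ) := by
  rw [riemannianHessian_dingOnCone_eq_christoffel s hHref h hμ hk,
    integral_re_fsInner_xi s h hμ hk]
  ring

end Ding

end

end QuantizedDing

open MeasureTheory in
theorem theorem1p1_general {n : ℕ} {X : Type*} [TopologicalSpace X] [CompactSpace X] [Nonempty X]
    [MeasurableSpace X] [BorelSpace X] [ChartedSpace (Model n) X]
    [IsManifold 𝓘(ℂ, Model n) ω X]
    {k : ℕ} (hk : 0 < k) (h : ∀ x : X, ∃ σ : H0 n X k, σ x ≠ 0)
    {N : ℕ} (H₀ Href : SesqForm (H0 n X k)) (hHref : IsHermForm Href)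
    (s₀ : Module.Basis (Fin N) ℂ (H0 n X k))
    (hs₀ : ∀ i j, H₀ (s₀ i) (s₀ j) = if i = j then 1 else 0)
    (ι : X → CP N) (hι : ι = kodairaMap s₀ h)
    (μ : Measure X) (hμ : μ = canonicalProbability (fubiniStudyWeight H₀)) :
    ContDiffAt ℝ 2 (dingOnCone s₀ Href) (idHerm N) ∧
    (∀ A B : HermMat N,
      riemannianHessian (dingOnCone s₀ Href) (idHerm N) A B =
        (k : ℝ)⁻¹ * (∫ x, (fsInner (ι x) (xi A (ι x)) (xi B (ι x))).re ∂μ)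
        - ((k : ℝ) ^ 2)⁻¹ * (∫ x, hamiltonian A (ι x) * hamiltonian B (ι x) ∂μ)
        + ((k : ℝ) ^ 2)⁻¹ *
          ((∫ x, hamiltonian A (ι x) ∂μ) * (∫ x, hamiltonian B (ι x) ∂μ))) ∧
    (∀ (A : HermMat N) (p : CP N) (Z : p.submodule) (w : Vec N) (η : TangentCP p), Z ≠ 0 →
      η Z = p.submodule.mkQ w →
      HasDerivAt (fun t : ℝ => (A.1 * momentMatrix ((Z : Vec N) + t • w)).trace.re)
        (-(4 * Real.pi) * fsForm p (Complex.I • xiReal A p) η) 0) := by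
  subst hι
  rw [eq_formOf_of_orthonormal s₀ hs₀] at hμ
  exact ⟨contDiffAt_dingOnCone s₀ hHref h hk, riemannianHessian_dingOnCone s₀ hHref h hμ hk,
    fun A _ _ _ _ hZ hη => hasDerivAt_re_trace_mul_momentMatrix A hZ hη⟩

theorem theorem1p1 {n : ℕ} {X : Type*} [TopologicalSpace X] [T2Space X] [CompactSpace X]
    [ConnectedSpace X] [MeasurableSpace X] [BorelSpace X] [ChartedSpace (Model n) X]
    [IsManifold 𝓘(ℂ, Model n) ω X] (hX : IsFano n X)
    {k : ℕ} (hk : 0 < k) (hva : IsVeryAmple n X k)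
    {N : ℕ} (H₀ Href : SesqForm (H0 n X k)) (hH₀ : IsHermForm H₀) (hHref : IsHermForm Href)
    (s₀ : Module.Basis (Fin N) ℂ (H0 n X k))
    (hs₀ : ∀ i j, H₀ (s₀ i) (s₀ j) = if i = j then 1 else 0)
    (ι : X → CP N) (hι : ι = kodairaMap s₀ hva.basePointFree)
    (μ : MeasureTheory.Measure X) (hμ : μ = canonicalProbability (fubiniStudyWeight H₀)) :
    -- the functional is twice differentiable at `H₀`, and its Hessian there is:
    ContDiffAt ℝ 2 (dingOnCone s₀ Href) (idHerm N) ∧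
    (∀ A B : HermMat N,
      riemannianHessian (dingOnCone s₀ Href) (idHerm N) A B =
        (k : ℝ)⁻¹ * (∫ x, (fsInner (ι x) (xi A (ι x)) (xi B (ι x))).re ∂μ)
        - ((k : ℝ) ^ 2)⁻¹ * (∫ x, hamiltonian A (ι x) * hamiltonian B (ι x) ∂μ)
        + ((k : ℝ) ^ 2)⁻¹ *
          ((∫ x, hamiltonian A (ι x) ∂μ) * (∫ x, hamiltonian B (ι x) ∂μ))) ∧
    -- `H(A)` is the Hamiltonian of `J ξ_A^ℝ`: its differential is `-4π ω_FS(J ξ_A^ℝ, ·)`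
    (∀ (A : HermMat N) (p : CP N) (Z : p.submodule) (w : Vec N) (η : TangentCP p), Z ≠ 0 →
      η Z = p.submodule.mkQ w →
      HasDerivAt (fun t : ℝ => (A.1 * momentMatrix ((Z : Vec N) + t • w)).trace.re)
        (-(4 * Real.pi) * fsForm p (Complex.I • xiReal A p) η) 0) :=
  theorem1p1_general hk hva.basePointFree H₀ Href hHref s₀ hs₀ ι hι μ hμ
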